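/- Let $\sum_k\varepsilon_{t_k}$ be a Poisson point process on $(0,\infty)$ of intensity $\lambda>0$, let the marks $a_k$ be i.i.d. random variables with values in $\{0,1,2,\dots\}$, independent of $(t_k)$, with generating function $g(z)=E[z^{a_1}]$, and let $A(t)=\sum_k a_k\mathbf 1_{\{t_k\le t\}}$. Let $\Delta_0,\Delta_1,\Delta_2,\dots$ be independent nonnegative random variables, independent of the marked process $(t_k,a_k)_k$, such that $\Delta_1,\Delta_2,\dots$ are identically distributed and not almost surely $0$. Put $\tau_n=\Delta_0+\dots+\Delta_n$, $\tau_{-1}=0$, $A_n=A(\tau_n)$, $A_{-1}=0$, $X_n=A_n-A_{n-1}$, and $$\gamma_0(z,\theta)=E\left[z^{X_0}e^{-\theta\Delta_0}\right],\qquad \gamma(z,\theta)=E\left[z^{X_1}e^{-\theta\Delta_1}\right].$$ For an integer $M\ge 0$ let $\nu=\inf\{n\ge 0: A_n>M\}$. For $|u|,|v|,|y|\le 1$, $\mathrm{Re}\,w\ge 0$, $\mathrm{Re}\,x\ge 0$, $\mathrm{Re}\,\theta>0$ let $$G_2^*(\theta,u,v,w,x,y)=\int_0^\infty e^{-\theta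 t}\,E\left[u^{A_{\nu-1}}v^{A_\nu}e^{-w\tau_{\nu-1}-x\Delta_\nu}y^{A(t)}\mathbf 1_{\{\nu<\infty,\ \tau_{\nu-1}\le t<\tau_\nu\}}\right]dt .$$ For $k\ge 0$ and $\varphi$ analytic at $0$ let $$\mathcal D_s^k(\varphi(s))=\lim_{s\to 0}\frac1{k!}\frac{\partial^k}{\partial s^k}\left[\frac{\varphi(s)}{1-s}\right].$$ Assume $\theta+\lambda g(v)-\lambda g(vy)\ne 0$, and define, as functions of $s$ near $0$, $$\Gamma_0=\frac{\gamma_0(v,x)-\gamma_0(vy,\theta+x)}{\theta+\lambda g(v)-\lambda g(vy)}-\frac{\gamma_0(vs,x)-\gamma_0(vys,\theta+x)}{\theta+\lambda g(vs)-\lambda g(vys)},$$ $$\Gamma=\frac{\gamma(v,x)-\gamma(vy,\theta+x)}{\theta+\lambda g(v)-\lambda g(vy)}-\frac{\gamma(vs,x)-\gamma(vys,\theta+x)}{\theta+\lambda g(vs)-\lambda g(vys)},\qquad B_3=\frac{\gamma_0(uvys,\theta+w)}{1-\gamma(uvys,\theta+w)} .$$ Then the expectation and the integral defining $G_2^*$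 converge absolutely, the denominators depending on $s$ do not vanish for $s$ near $0$, $\Gamma_0+\Gamma B_3$ is analytic at $s=0$, and $$G_2^*(\theta,u,v,w,x,y)=\mathcal D_s^{M}\left(\Gamma_0+\Gamma B_3\right).$$ (Equivalently, for $M\ge 1$, the transform with $\nu$ replaced by $\inf\{n\ge 0:A_n\ge M\}$ equals $\mathcal D_s^{M-1}(\Gamma_0+\Gamma B_3)$.) -/

import Mathlib

open MeasureTheory ProbabilityTheory Filter Topology
open scoped NNReal

noncomputable section

namespace DelayedPassage

variable {Ω : Type*}

/-- Number of epochs in `[0, s]`: the counting process `N(s) = #{k : t_k ≤ s}`. -/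
def count (t : ℕ → Ω → ℝ) (s : ℝ≥0) (ω : Ω) : ℕ :=
  {k : ℕ | t k ω ≤ (s : ℝ)}.ncard

/-- The epochs `t_0, t_1, …` (in no prescribed order) form a homogeneous Poisson point process of
intensity `lam` on the positive half-line: almost surely they are positive and locally finite in
number, and the counting process has independent Poisson distributed increments. -/
structure IsPoissonPointProcess [MeasurableSpace Ω] (P : Measure Ω) (lam : ℝ≥0)
    (t : ℕ → Ω → ℝ) : Prop where
  measurable : ∀ k, Measurable (t k)
  pos : ∀ᵐ ω ∂P, ∀ k, 0 < t k ω
  locallyFinite : ∀ᵐ ω ∂P, ∀ s : ℝ, {k : ℕ | t k ω ≤ s}.Finite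
  law_increment : ∀ r s : ℝ≥0, r ≤ s →
    HasLaw (fun ω => count t s ω - count t r ω) (poissonMeasure (lam * (s - r))) P
  indep_increments : HasIndepIncrements (count t) P

/-- The marked process `A(s) = ∑_k a_k 1{t_k ≤ s}`. -/
def A (t : ℕ → Ω → ℝ) (a : ℕ → Ω → ℕ) (s : ℝ) (ω : Ω) : ℕ :=
  ∑' k, if t k ω ≤ s then a k ω else 0

/-- Observation times `τ_n = Δ_0 + … + Δ_n`. -/
def tau (Δ : ℕ → Ω → ℝ) (n : ℕ) (ω : Ω) : ℝ :=
  ∑ i ∈ Finset.range (n + 1), Δ i ω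

/-- `tauPrev Δ n` is `τ_{n-1}`, with `τ_{-1} = 0`. -/
def tauPrev (Δ : ℕ → Ω → ℝ) : ℕ → Ω → ℝ
  | 0, _ => 0
  | n + 1, ω => tau Δ n ω

/-- Observed values `A_n = A(τ_n)`. -/
def obs (t : ℕ → Ω → ℝ) (a : ℕ → Ω → ℕ) (Δ : ℕ → Ω → ℝ) (n : ℕ) (ω : Ω) : ℕ :=
  A t a (tau Δ n ω) ω

/-- `obsPrev t a Δ n` is `A_{n-1}`, with `A_{-1} = 0`. -/
def obsPrev (t : ℕ → Ω → ℝ) (a : ℕ → Ω → ℕ) (Δ : ℕ → Ω → ℝ) : ℕ → Ω → ℕ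
  | 0, _ => 0
  | n + 1, ω => obs t a Δ n ω

/-- Observed increments `X_n = A_n - A_{n-1}` (almost surely `A_{n-1} ≤ A_n`, so the subtraction of
natural numbers is the true one). -/
def incr (t : ℕ → Ω → ℝ) (a : ℕ → Ω → ℕ) (Δ : ℕ → Ω → ℝ) (n : ℕ) (ω : Ω) : ℕ :=
  obs t a Δ n ω - obsPrev t a Δ n ω

/-- The event `{ν < ∞}` that some observed value exceeds the threshold `M`. -/
def crossed (t : ℕ → Ω → ℝ) (a : ℕ → Ω → ℕ) (Δ : ℕ → Ω → ℝ) (M : ℕ) : Set Ω :=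
  {ω | ∃ n, M < obs t a Δ n ω}

/-- The exit index `ν = inf {n ≥ 0 : A_n > M}`; used only on the event `crossed t a Δ M`. -/
def exitIndex (t : ℕ → Ω → ℝ) (a : ℕ → Ω → ℕ) (Δ : ℕ → Ω → ℝ) (M : ℕ) (ω : Ω) : ℕ :=
  sInf {n : ℕ | M < obs t a Δ n ω}

/-- The standing assumptions: the epochs form a Poisson process of intensity `lam > 0`, the marks
are IID and independent of the epochs, the `Δ_n` are nonnegative and independent, those with
`n ≥ 1` have a common law other than the point mass at `0`, and the sequence `(Δ_n)` is independent
of the marked Poisson process. -/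
structure IsDelayedObservation [MeasurableSpace Ω] (P : Measure Ω) (lam : ℝ≥0)
    (t : ℕ → Ω → ℝ) (a : ℕ → Ω → ℕ) (Δ : ℕ → Ω → ℝ) : Prop where
  lam_pos : 0 < lam
  poisson : IsPoissonPointProcess P lam t
  measurable_mark : ∀ k, Measurable (a k)
  indep_mark : iIndepFun a P
  ident_mark : ∀ k, IdentDistrib (a k) (a 1) P P
  indep_mark_epoch : IndepFun (fun ω k => t k ω) (fun ω k => a k ω) P
  measurable_obs : ∀ n, Measurable (Δ n)
  nonneg_obs : ∀ n ω, 0 ≤ Δ n ω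
  indep_obs : iIndepFun Δ P
  ident_obs : ∀ n, 1 ≤ n → IdentDistrib (Δ n) (Δ 1) P P
  nondegenerate_obs : ¬ (∀ᵐ ω ∂P, Δ 1 ω = 0)
  indep_obs_process : IndepFun (fun ω n => Δ n ω) (fun ω k => (t k ω, a k ω)) P

/-- Common probability generating function of the marks, `g(z) = E[z^{a_1}]`. -/
def g [MeasurableSpace Ω] (P : Measure Ω) (a : ℕ → Ω → ℕ) (z : ℂ) : ℂ :=
  ∫ ω, z ^ a 1 ω ∂P

/-- `gam P t a Δ n z θ = E[z^{X_n} e^{-θ Δ_n}]`; the function `γ_0` is the case `n = 0` and `γ` the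
case `n = 1`. -/
def gam [MeasurableSpace Ω] (P : Measure Ω) (t : ℕ → Ω → ℝ) (a : ℕ → Ω → ℕ) (Δ : ℕ → Ω → ℝ)
    (n : ℕ) (z θ : ℂ) : ℂ :=
  ∫ ω, z ^ incr t a Δ n ω * Complex.exp (-θ * (Δ n ω : ℂ)) ∂P

/-- The random variable
`u^{A_{ν-1}} v^{A_ν} e^{-w τ_{ν-1} - x Δ_ν} y^{A(r)} 1{τ_{ν-1} ≤ r < τ_ν}`, where the event
includes `ν < ∞`. -/
def G2integrand (t : ℕ → Ω → ℝ) (a : ℕ → Ω → ℕ) (Δ : ℕ → Ω → ℝ) (M : ℕ)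
    (u v w x y : ℂ) (r : ℝ) : Ω → ℂ :=
  Set.indicator
    {ω | ω ∈ crossed t a Δ M ∧ tauPrev Δ (exitIndex t a Δ M ω) ω ≤ r ∧
      r < tau Δ (exitIndex t a Δ M ω) ω}
    (fun ω =>
      let ν := exitIndex t a Δ M ω
      u ^ obsPrev t a Δ ν ω * v ^ obs t a Δ ν ω *
        Complex.exp (-w * (tauPrev Δ ν ω : ℂ) - x * (Δ ν ω : ℂ)) * y ^ A t a r ω)

/-- The functional `G_2(r, u, v, w, x, y)`. -/
def G2 [MeasurableSpace Ω] (P : Measure Ω) (t : ℕ → Ω → ℝ) (a : ℕ → Ω → ℕ) (Δ : ℕ → Ω → ℝ)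
    (M : ℕ) (u v w x y : ℂ) (r : ℝ) : ℂ :=
  ∫ ω, G2integrand t a Δ M u v w x y r ω ∂P

/-- The Laplace transform `G_2^*(θ, u, v, w, x, y)` of `G_2` in the time variable. -/
def G2star [MeasurableSpace Ω] (P : Measure Ω) (t : ℕ → Ω → ℝ) (a : ℕ → Ω → ℕ)
    (Δ : ℕ → Ω → ℝ) (M : ℕ) (θ u v w x y : ℂ) : ℂ :=
  ∫ r in Set.Ici (0 : ℝ), Complex.exp (-θ * (r : ℂ)) * G2 P t a Δ M u v w x y r

/-- The operator `𝒟_s^k(φ) = lim_{s → 0} (1/k!) ∂^k/∂s^k [φ(s) / (1 - s)]`. -/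
def calD (k : ℕ) (φ : ℂ → ℂ) : ℂ :=
  limUnder (𝓝[≠] (0 : ℂ)) fun s =>
    (1 / (k.factorial : ℂ)) * iteratedDeriv k (fun s' => 1 / (1 - s') * φ s') s

/-- The denominator `θ + λ g(z) - λ g(z y)`. -/
def den [MeasurableSpace Ω] (P : Measure Ω) (lam : ℝ≥0) (a : ℕ → Ω → ℕ) (θ y z : ℂ) : ℂ :=
  θ + (lam : ℂ) * g P a z - (lam : ℂ) * g P a (z * y)

/-- `Γ_0` (for `n = 0`) and `Γ` (for `n = 1`) as functions of `s`. -/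
def Gam [MeasurableSpace Ω] (P : Measure Ω) (lam : ℝ≥0) (t : ℕ → Ω → ℝ) (a : ℕ → Ω → ℕ)
    (Δ : ℕ → Ω → ℝ) (n : ℕ) (θ v x y s : ℂ) : ℂ :=
  (gam P t a Δ n v x - gam P t a Δ n (v * y) (θ + x)) / den P lam a θ y v -
    (gam P t a Δ n (v * s) x - gam P t a Δ n (v * s * y) (θ + x)) / den P lam a θ y (v * s)

/-- `B_3` as a function of `s`. -/
def B3 [MeasurableSpace Ω] (P : Measure Ω) (t : ℕ → Ω → ℝ) (a : ℕ → Ω → ℕ) (Δ : ℕ → Ω → ℝ)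
    (θ u v w y s : ℂ) : ℂ :=
  gam P t a Δ 0 (u * v * y * s) (θ + w) / (1 - gam P t a Δ 1 (u * v * y * s) (θ + w))

end DelayedPassage

end

noncomputable section

namespace DelayedPassage

variable {Ω : Type*}

/-! ### Auxiliary facts on measurability and independence -/

/-! The proof computes the generating function in the threshold, `∑_M s^M G₂*(M)`, for small `s`,
and reads off its coefficients.

Fix a time `r` and a path. At most one `n` satisfies `τ_{n-1} ≤ r < τ_n`, and since `A` is
nondecreasing, `ν = n` exactly when `A_{n-1} ≤ M < A_n`. Hence `(1-s) ∑_M s^M 1{ν = n} = s^{A_{n-1}}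
- s^{A_n}`. Splitting `A_n` at `A_{n-1}` and `A(r)` turns the weight into a difference of two
products of powers of the increments of `A` over `(0, τ_{n-1}]`, `(τ_{n-1}, r]`, `(r, τ_n]`: the
bases are `uvys, vy, v` in the first product and `uvys, vsy, vs` in the second (`kernelDiff_eq`).

Given the observation times, `A` is compound Poisson, so each base `z` contributes
`exp(-λ(1-g(z))·length)` (`integral_pow_A`, `integral_pow_A_random`). Integrating over `r` in the
interval produces the denominators `θ + λg(z) - λg(zy)`, and independence of `τ_{n-1}` and `Δ_n`
factors the result (`integral_kernel`). The `n`-th term is `∏_{i<n} γ_i(uvys, θ+w)` times `Γ_0` if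
`n = 0` and `Γ` otherwise. As `|γ| < 1` (`norm_gam_one_lt_one`), the geometric series over `n` gives
`Γ_0 + Γ B_3`.

Thus `(Γ_0 + Γ B_3)/(1-s)` is a power series near `0` with coefficients `G₂*(M)`, which yields both
analyticity and the formula (`calD_eq_of_hasSum`). -/

lemma eventually_zero_of_summable_nat {f : ℕ → ℕ} (hf : Summable f) : ∃ n, ∀ k ≥ n, f k = 0 := by
  have h := hf.hasSum.tendsto_sum_nat
  -- In the discrete space `ℕ`, convergent partial sums are eventually constant.
  rw [nhds_discrete, tendsto_pure, eventually_atTop] at h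
  obtain ⟨n, hn⟩ := h
  refine ⟨n, fun k hk => ?_⟩
  have h1 := hn k hk
  have h2 := hn (k + 1) (by omega)
  rw [Finset.sum_range_succ] at h2
  omega

/-- Off the set `S` of eventually vanishing sequences the sum has the default value `0`, so the
partial sums cut off to `S` converge to it everywhere. -/
lemma measurable_tsum_nat {X : Type*} [MeasurableSpace X] {f : ℕ → X → ℕ}
    (hf : ∀ k, Measurable (f k)) : Measurable fun x => ∑' k, f k x := by
  classical
  set S : Set X := {x | ∃ n, ∀ k ≥ n, f k x = 0} with hS
  have hSm : MeasurableSet S := by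
    have : S = ⋃ n, ⋂ k, ⋂ (_ : k ≥ n), f k ⁻¹' {0} := by
      ext x; simp [hS]
    rw [this]
    exact MeasurableSet.iUnion fun n => MeasurableSet.iInter fun k => MeasurableSet.iInter fun _ =>
      hf k (measurableSet_singleton 0)
  refine measurable_of_tendsto_metrizable
    (f := fun n => S.indicator fun x => ∑ k ∈ Finset.range n, f k x)
    (fun n => (Finset.measurable_sum _ fun k _ => hf k).indicator hSm) ?_
  rw [tendsto_pi_nhds]
  intro x
  by_cases hx : x ∈ S
  · simp only [Set.indicator_of_mem hx]
    obtain ⟨n, hn⟩ := hx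
    have : Summable fun k => f k x := by
      refine summable_of_hasFiniteSupport ((Finset.range n).finite_toSet.subset fun k hk => ?_)
      by_contra hkn
      exact hk (hn k (by simpa using hkn))
    exact this.hasSum.tendsto_sum_nat
  · simp only [Set.indicator_of_notMem hx]
    rw [tsum_eq_zero_of_not_summable fun hs => hx (eventually_zero_of_summable_nat hs)]
    exact tendsto_const_nhds

/-- Fubini for the product law. It serves to freeze the epochs while averaging over the marks, and
the observation times while averaging over the marked process. -/
lemma integral_comp_of_indepFun [MeasurableSpace Ω] {P : Measure Ω} [IsProbabilityMeasure P]
    {α β : Type*} [MeasurableSpace α] [MeasurableSpace β] {X : Ω → α} {Y : Ω → β}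
    (hXY : IndepFun X Y P) (hX : Measurable X) (hY : Measurable Y) {F : α × β → ℂ}
    (hF : Measurable F) (hint : Integrable (fun ω => F (X ω, Y ω)) P) :
    ∫ ω, F (X ω, Y ω) ∂P = ∫ ω, ∫ ω', F (X ω, Y ω') ∂P ∂P := by
  have : IsProbabilityMeasure (P.map X) := Measure.isProbabilityMeasure_map hX.aemeasurable
  have : IsProbabilityMeasure (P.map Y) := Measure.isProbabilityMeasure_map hY.aemeasurable
  have hmap := (indepFun_iff_map_prod_eq_prod_map_map hX.aemeasurable hY.aemeasurable).1 hXY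
  have hFs : StronglyMeasurable F := hF.stronglyMeasurable
  have hi : Integrable F ((P.map X).prod (P.map Y)) := by
    rw [← hmap, integrable_map_measure hFs.aestronglyMeasurable (hX.prodMk hY).aemeasurable]
    exact hint
  rw [← integral_map (f := F) (hX.prodMk hY).aemeasurable hFs.aestronglyMeasurable, hmap,
    integral_prod _ hi, integral_map hX.aemeasurable
      hFs.integral_prod_right'.aestronglyMeasurable]
  refine integral_congr_ae (Eventually.of_forall fun ω => ?_)
  exact integral_map hY.aemeasurable
    (hFs.comp_measurable measurable_prodMk_left).aestronglyMeasurable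

lemma integral_pow_poissonMeasure (r : ℝ≥0) (z : ℂ) :
    ∫ n, z ^ n ∂(poissonMeasure r) = Complex.exp (r * (z - 1)) := by
  rw [integral_poissonMeasure]
  have h := (NormedSpace.expSeries_div_hasSum_exp ((r : ℂ) * z)).mul_left (Complex.exp (-r))
  rw [← Complex.exp_eq_exp_ℂ, ← Complex.exp_add] at h
  rw [show (r : ℂ) * (z - 1) = -r + r * z by ring, ← h.tsum_eq]
  congr 1 with n
  rw [Complex.real_smul]
  push_cast
  rw [mul_pow]
  ring

/-! ### Paths of the marked process -/

lemma measurable_A [MeasurableSpace Ω] {t : ℕ → Ω → ℝ} {a : ℕ → Ω → ℕ}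
    (ht : ∀ k, Measurable (t k)) (ha : ∀ k, Measurable (a k)) :
    Measurable fun p : ℝ × Ω => A t a p.1 p.2 :=
  measurable_tsum_nat fun k => Measurable.ite
    (measurableSet_le ((ht k).comp measurable_snd) measurable_fst)
    ((ha k).comp measurable_snd) measurable_const

/-- One finite index set, the epochs up to `q`, serves all times `s ≤ q`, so values at different
times can be compared term by term. -/
lemma A_eq_sum (t : ℕ → Ω → ℝ) (a : ℕ → Ω → ℕ) {ω : Ω} {s q : ℝ} (hsq : s ≤ q)
    (hf : {k | t k ω ≤ q}.Finite) :
    A t a s ω = ∑ k ∈ hf.toFinset, if t k ω ≤ s then a k ω else 0 := by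
  refine tsum_eq_sum fun k hk => if_neg fun h => hk ?_
  simpa using h.trans hsq

lemma count_eq_A (t : ℕ → Ω → ℝ) {ω : Ω} {s : ℝ≥0} (hf : {k | t k ω ≤ (s : ℝ)}.Finite) :
    count t s ω = A t (fun _ _ => 1) s ω := by
  rw [A_eq_sum t _ le_rfl hf, count, Set.ncard_eq_toFinset_card _ hf, Finset.card_eq_sum_ones]
  refine Finset.sum_congr rfl fun k hk => (if_pos ?_).symm
  simpa using hk

lemma A_mono {t : ℕ → Ω → ℝ} (a : ℕ → Ω → ℕ) {ω : Ω} (hf : ∀ s : ℝ, {k | t k ω ≤ s}.Finite) :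
    Monotone fun s => A t a s ω := by
  intro s r hsr
  simp only
  rw [A_eq_sum t a hsr (hf r), A_eq_sum t a le_rfl (hf r)]
  refine Finset.sum_le_sum fun k _ => ?_
  split_ifs with h1 h2 <;>
    first | exact le_rfl | exact Nat.zero_le _ | exact absurd (h1.trans hsr) h2

/-- Each epoch up to `q` contributes its mark to exactly one of the three exponents. In product
form, independence of the marks acts factor by factor. -/
lemma pow_A_eq_prod {t : ℕ → Ω → ℝ} (a : ℕ → Ω → ℕ) {ω : Ω}
    (hf : ∀ s : ℝ, {k | t k ω ≤ s}.Finite) {s r q : ℝ} (hsr : s ≤ r) (hrq : r ≤ q)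
    (z₀ z₁ z₂ : ℂ) :
    z₀ ^ A t a s ω * z₁ ^ (A t a r ω - A t a s ω) * z₂ ^ (A t a q ω - A t a r ω) =
      ∏ k ∈ (hf q).toFinset,
        (if t k ω ≤ s then z₀ else if t k ω ≤ r then z₁ else z₂) ^ a k ω := by
  have e1 : A t a r ω - A t a s ω =
      ∑ k ∈ (hf q).toFinset, if t k ω ≤ s then 0 else if t k ω ≤ r then a k ω else 0 := by
    rw [A_eq_sum t a (hsr.trans hrq) (hf q), A_eq_sum t a hrq (hf q), Nat.sub_eq_iff_eq_add,
      ← Finset.sum_add_distrib]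
    · refine Finset.sum_congr rfl fun k _ => ?_
      by_cases h1 : t k ω ≤ s
      · simp [h1, h1.trans hsr]
      · simp [h1]
    · have := A_mono a hf hsr
      simpa only [A_eq_sum t a (hsr.trans hrq) (hf q), A_eq_sum t a hrq (hf q)] using this
  have e2 : A t a q ω - A t a r ω =
      ∑ k ∈ (hf q).toFinset, if t k ω ≤ r then 0 else a k ω := by
    rw [A_eq_sum t a hrq (hf q), A_eq_sum t a le_rfl (hf q), Nat.sub_eq_iff_eq_add,
      ← Finset.sum_add_distrib]
    · refine Finset.sum_congr rfl fun k hk => ?_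
      have : t k ω ≤ q := by simpa using hk
      rw [if_pos this]
      split_ifs <;> omega
    · have := A_mono a hf hrq
      simpa only [A_eq_sum t a hrq (hf q), A_eq_sum t a le_rfl (hf q)] using this
  rw [e1, e2, A_eq_sum t a (hsr.trans hrq) (hf q), ← Finset.prod_pow_eq_pow_sum,
    ← Finset.prod_pow_eq_pow_sum, ← Finset.prod_pow_eq_pow_sum, ← Finset.prod_mul_distrib,
    ← Finset.prod_mul_distrib]
  refine Finset.prod_congr rfl fun k _ => ?_
  by_cases h1 : t k ω ≤ s
  · simp [h1, h1.trans hsr]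
  · by_cases h2 : t k ω ≤ r <;> simp [h1, h2]

/-! ### The compound Poisson formula -/

section

variable [MeasurableSpace Ω] {P : Measure Ω} {lam : ℝ≥0}
  {t : ℕ → Ω → ℝ} {a : ℕ → Ω → ℕ} {Δ : ℕ → Ω → ℝ}

lemma integral_pow_mark (h : IsDelayedObservation P lam t a Δ) (k : ℕ) (z : ℂ) :
    ∫ ω, z ^ a k ω ∂P = g P a z :=
  ((h.ident_mark k).comp (u := fun n : ℕ => z ^ n) (measurable_of_countable _)).integral_eq

lemma integral_prod_pow_mark (h : IsDelayedObservation P lam t a Δ) (K : Finset ℕ) (z : ℕ → ℂ) :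
    ∫ ω, ∏ k ∈ K, z k ^ a k ω ∂P = ∏ k ∈ K, g P a (z k) := by
  have hK : iIndepFun (fun k : K => a k) P := h.indep_mark.precomp Subtype.val_injective
  have := hK.integral_fun_prod_comp (f := fun (k : K) (n : ℕ) => z k ^ n)
    (fun k => (h.measurable_mark k).aemeasurable)
    (fun k => (measurable_of_countable _).aestronglyMeasurable)
  simp only [integral_pow_mark h] at this
  rw [← Finset.prod_coe_sort K fun k => g P a (z k), ← this]
  congr 1 with ω
  exact (Finset.prod_coe_sort K fun k => z k ^ a k ω).symm

lemma integral_pow_count (h : IsPoissonPointProcess P lam t) [IsProbabilityMeasure P]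
    {s r q : ℝ≥0} (hsr : s ≤ r) (hrq : r ≤ q) (z₀ z₁ z₂ : ℂ) :
    ∫ ω, z₀ ^ count t s ω * z₁ ^ (count t r ω - count t s ω) *
        z₂ ^ (count t q ω - count t r ω) ∂P =
      Complex.exp (lam * s * (z₀ - 1) + lam * (r - s) * (z₁ - 1) + lam * (q - r) * (z₂ - 1)) := by
  -- The point `0` is prepended so that `count t s` is, almost surely, an increment as well.
  set T : Fin 4 → ℝ≥0 := ![0, s, r, q] with hT
  have hTm : Monotone T := by
    rw [Fin.monotone_iff_le_succ]
    intro i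
    fin_cases i <;> simp [hT, hsr, hrq]
  have hlaw : ∀ i : Fin 3, HasLaw (fun ω => count t (T i.succ) ω - count t (T i.castSucc) ω)
      (poissonMeasure (lam * (T i.succ - T i.castSucc))) P := fun i =>
    h.law_increment _ _ (hTm i.castSucc_lt_succ.le)
  have key := (h.indep_increments 3 T hTm).integral_fun_prod_comp
    (f := fun i n => (![z₀, z₁, z₂] i) ^ n) (fun i => (hlaw i).aemeasurable)
    (fun i => (measurable_of_countable _).aestronglyMeasurable)
  have hE : ∀ i : Fin 3, ∫ ω, (![z₀, z₁, z₂] i) ^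
      (count t (T i.succ) ω - count t (T i.castSucc) ω) ∂P =
      Complex.exp ((lam * (T i.succ - T i.castSucc) : ℝ≥0) * (![z₀, z₁, z₂] i - 1)) := fun i => by
    rw [← integral_pow_poissonMeasure]
    exact (hlaw i).integral_comp (f := fun n : ℕ => (![z₀, z₁, z₂] i) ^ n)
      (measurable_of_countable _).aestronglyMeasurable
  have h0 : ∀ᵐ ω ∂P, count t 0 ω = 0 := by
    filter_upwards [h.pos] with ω hω
    have : {k : ℕ | t k ω ≤ ((0 : ℝ≥0) : ℝ)} = ∅ := by
      ext k; simpa using hω k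
    rw [count, this, Set.ncard_empty]
  calc _ = ∫ ω, ∏ i : Fin 3, (![z₀, z₁, z₂] i) ^
      (count t (T i.succ) ω - count t (T i.castSucc) ω) ∂P := by
        refine integral_congr_ae ?_
        filter_upwards [h0] with ω hω
        simp [Fin.prod_univ_three, hT, hω]
    _ = _ := by
      rw [key, Finset.prod_congr rfl fun i _ => hE i, ← Complex.exp_sum]
      congr 1
      simp [Fin.sum_univ_three, hT, NNReal.coe_sub hsr, NNReal.coe_sub hrq]

/-- The exponent of the compound Poisson process `A`: `E[z^{A(s)}] = exp (-(rate z) s)`. -/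
def rate (P : Measure Ω) (lam : ℝ≥0) (a : ℕ → Ω → ℕ) (z : ℂ) : ℂ := lam * (1 - g P a z)

lemma norm_mul_le_one {z z' : ℂ} (hz : ‖z‖ ≤ 1) (hz' : ‖z'‖ ≤ 1) : ‖z * z'‖ ≤ 1 := by
  rw [norm_mul]
  exact mul_le_one₀ hz (norm_nonneg _) hz'

lemma norm_prod_pow_le_one {z₀ z₁ z₂ : ℂ} (h₀ : ‖z₀‖ ≤ 1) (h₁ : ‖z₁‖ ≤ 1) (h₂ : ‖z₂‖ ≤ 1)
    (i j k : ℕ) : ‖z₀ ^ i * z₁ ^ j * z₂ ^ k‖ ≤ 1 := by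
  simp only [norm_mul, norm_pow]
  exact mul_le_one₀ (mul_le_one₀ (pow_le_one₀ (norm_nonneg _) h₀) (by positivity)
    (pow_le_one₀ (norm_nonneg _) h₁)) (by positivity) (pow_le_one₀ (norm_nonneg _) h₂)

/-- With the epochs frozen, averaging a mark replaces `z_i ^ a_k` by `g(z_i)`. What remains is the
generating function of independent Poisson counts at the points `g(z_i)`. -/
lemma integral_pow_A [IsProbabilityMeasure P] (h : IsDelayedObservation P lam t a Δ)
    {s r q : ℝ} (hs : 0 ≤ s) (hsr : s ≤ r) (hrq : r ≤ q) {z₀ z₁ z₂ : ℂ}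
    (h₀ : ‖z₀‖ ≤ 1) (h₁ : ‖z₁‖ ≤ 1) (h₂ : ‖z₂‖ ≤ 1) :
    ∫ ω, z₀ ^ A t a s ω * z₁ ^ (A t a r ω - A t a s ω) * z₂ ^ (A t a q ω - A t a r ω) ∂P =
      Complex.exp (-(rate P lam a z₀ * s) - rate P lam a z₁ * (r - s) -
        rate P lam a z₂ * (q - r)) := by
  lift q to ℝ≥0 using (hs.trans hsr).trans hrq
  lift r to ℝ≥0 using hs.trans hsr
  lift s to ℝ≥0 using hs
  -- Coordinate versions of epochs and marks exhibit `A` as a measurable function of the two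
  -- independent sequences.
  let tc : ℕ → (ℕ → ℝ) × (ℕ → ℕ) → ℝ := fun k p => p.1 k
  let ac : ℕ → (ℕ → ℝ) × (ℕ → ℕ) → ℕ := fun k p => p.2 k
  have hmA : ∀ b : ℝ, Measurable fun p => A tc ac b p := fun b =>
    (measurable_A (t := tc) (a := ac) (fun k => (measurable_pi_apply k).comp measurable_fst)
      (fun k => (measurable_pi_apply k).comp measurable_snd)).comp measurable_prodMk_left
  let F : (ℕ → ℝ) × (ℕ → ℕ) → ℂ := fun p =>
    z₀ ^ A tc ac s p * z₁ ^ (A tc ac r p - A tc ac s p) * z₂ ^ (A tc ac q p - A tc ac r p)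
  have hpow : ∀ z : ℂ, Measurable fun n : ℕ => z ^ n := fun z => measurable_of_countable _
  have hF : Measurable F :=
    (((hpow z₀).comp (hmA s)).mul ((hpow z₁).comp ((hmA r).sub (hmA s)))).mul
      ((hpow z₂).comp ((hmA q).sub (hmA r)))
  have htm : Measurable fun ω k => t k ω := measurable_pi_lambda _ h.poisson.measurable
  have ham : Measurable fun ω k => a k ω := measurable_pi_lambda _ h.measurable_mark
  have hint : Integrable (fun ω => F (fun k => t k ω, fun k => a k ω)) P :=
    Integrable.of_bound (hF.comp (htm.prodMk ham)).aestronglyMeasurable 1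
      (Eventually.of_forall fun ω => norm_prod_pow_le_one h₀ h₁ h₂ _ _ _)
  calc _ = ∫ ω, F (fun k => t k ω, fun k => a k ω) ∂P := rfl
    _ = ∫ ω, ∫ ω', F (fun k => t k ω, fun k => a k ω') ∂P ∂P :=
      integral_comp_of_indepFun h.indep_mark_epoch htm ham hF hint
    _ = ∫ ω, g P a z₀ ^ count t s ω *
          g P a z₁ ^ (count t r ω - count t s ω) *
          g P a z₂ ^ (count t q ω - count t r ω) ∂P := by
      refine integral_congr_ae ?_
      filter_upwards [h.poisson.locallyFinite] with ω hω
      rw [count_eq_A t (hω _), count_eq_A t (hω _), count_eq_A t (hω _)]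
      -- The product formula is used backwards, with unit marks and bases `g(z_i)`.
      refine Eq.trans ?_ (pow_A_eq_prod (fun _ _ => 1) hω hsr hrq _ _ _).symm
      calc _ = ∫ ω', ∏ k ∈ (hω q).toFinset,
            (if t k ω ≤ s then z₀ else if t k ω ≤ r then z₁ else z₂) ^ a k ω' ∂P := by
              refine integral_congr_ae (Eventually.of_forall fun ω' => ?_)
              exact pow_A_eq_prod (t := tc) ac (ω := (fun k => t k ω, fun k => a k ω'))
                hω hsr hrq z₀ z₁ z₂
        _ = _ := by
          rw [integral_prod_pow_mark h]
          refine Finset.prod_congr rfl fun k _ => ?_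
          split_ifs <;> simp
    _ = _ := by
      rw [integral_pow_count h.poisson (by exact_mod_cast hsr) (by exact_mod_cast hrq)]
      congr 1
      simp only [rate]
      ring

/-- The compound Poisson formula at times that depend on the observation process only. -/
lemma integral_pow_A_random [IsProbabilityMeasure P] (h : IsDelayedObservation P lam t a Δ)
    {f : (ℕ → ℝ) → ℂ} {S R Q : (ℕ → ℝ) → ℝ} (hf : Measurable f) (hS : Measurable S)
    (hR : Measurable R) (hQ : Measurable Q) (hfi : Integrable (fun ω => f fun n => Δ n ω) P)
    (hord : ∀ d : ℕ → ℝ, (∀ n, 0 ≤ d n) → f d ≠ 0 → 0 ≤ S d ∧ S d ≤ R d ∧ R d ≤ Q d)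
    {z₀ z₁ z₂ : ℂ} (h₀ : ‖z₀‖ ≤ 1) (h₁ : ‖z₁‖ ≤ 1) (h₂ : ‖z₂‖ ≤ 1) :
    ∫ ω, f (fun n => Δ n ω) * (z₀ ^ A t a (S fun n => Δ n ω) ω *
        z₁ ^ (A t a (R fun n => Δ n ω) ω - A t a (S fun n => Δ n ω) ω) *
        z₂ ^ (A t a (Q fun n => Δ n ω) ω - A t a (R fun n => Δ n ω) ω)) ∂P =
      ∫ ω, f (fun n => Δ n ω) * Complex.exp (-(rate P lam a z₀ * S fun n => Δ n ω) -
        rate P lam a z₁ * ((R fun n => Δ n ω) - S fun n => Δ n ω) -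
        rate P lam a z₂ * ((Q fun n => Δ n ω) - R fun n => Δ n ω)) ∂P := by
  let tc : ℕ → (ℕ → ℝ × ℕ) → ℝ := fun k p => (p k).1
  let ac : ℕ → (ℕ → ℝ × ℕ) → ℕ := fun k p => (p k).2
  have hmA : ∀ {b : (ℕ → ℝ) → ℝ}, Measurable b →
      Measurable fun p : (ℕ → ℝ) × (ℕ → ℝ × ℕ) => A tc ac (b p.1) p.2 := fun hb =>
    (measurable_A (t := tc) (a := ac) (fun k => measurable_fst.comp (measurable_pi_apply k))
      (fun k => measurable_snd.comp (measurable_pi_apply k))).comp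
      ((hb.comp measurable_fst).prodMk measurable_snd)
  let F : (ℕ → ℝ) × (ℕ → ℝ × ℕ) → ℂ := fun p =>
    f p.1 * (z₀ ^ A tc ac (S p.1) p.2 * z₁ ^ (A tc ac (R p.1) p.2 - A tc ac (S p.1) p.2) *
      z₂ ^ (A tc ac (Q p.1) p.2 - A tc ac (R p.1) p.2))
  have hpow : ∀ z : ℂ, Measurable fun n : ℕ => z ^ n := fun z => measurable_of_countable _
  have hF : Measurable F := (hf.comp measurable_fst).mul
    ((((hpow z₀).comp (hmA hS)).mul ((hpow z₁).comp ((hmA hR).sub (hmA hS)))).mul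
      ((hpow z₂).comp ((hmA hQ).sub (hmA hR))))
  have hdm : Measurable fun ω n => Δ n ω := measurable_pi_lambda _ h.measurable_obs
  have hpm : Measurable fun ω k => (t k ω, a k ω) :=
    measurable_pi_lambda _ fun k => (h.poisson.measurable k).prodMk (h.measurable_mark k)
  have hint : Integrable (fun ω => F (fun n => Δ n ω, fun k => (t k ω, a k ω))) P := by
    refine hfi.mono (hF.comp (hdm.prodMk hpm)).aestronglyMeasurable
      (Eventually.of_forall fun ω => ?_)
    simp only [F]
    rw [norm_mul]
    exact mul_le_of_le_one_right (norm_nonneg _) (norm_prod_pow_le_one h₀ h₁ h₂ _ _ _)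
  calc _ = ∫ ω, F (fun n => Δ n ω, fun k => (t k ω, a k ω)) ∂P := rfl
    _ = ∫ ω, ∫ ω', F (fun n => Δ n ω, fun k => (t k ω', a k ω')) ∂P ∂P :=
      integral_comp_of_indepFun h.indep_obs_process hdm hpm hF hint
    _ = _ := by
      refine integral_congr_ae (Eventually.of_forall fun ω => ?_)
      simp only [F]
      rw [integral_const_mul]
      -- Where `f` vanishes the three times may be out of order, but both sides are zero.
      by_cases hfd : f (fun n => Δ n ω) = 0
      · simp [hfd]
      · obtain ⟨i1, i2, i3⟩ := hord _ (fun n => h.nonneg_obs n ω) hfd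
        congr 1
        exact integral_pow_A h i1 i2 i3 h₀ h₁ h₂

end

/-! ### Observation times -/

lemma tauPrev_eq_sum (Δ : ℕ → Ω → ℝ) (n : ℕ) (ω : Ω) :
    tauPrev Δ n ω = ∑ i ∈ Finset.range n, Δ i ω := by
  cases n <;> simp [tauPrev, tau]

lemma tau_eq_tauPrev_add (Δ : ℕ → Ω → ℝ) (n : ℕ) (ω : Ω) :
    tau Δ n ω = tauPrev Δ n ω + Δ n ω := by
  rw [tauPrev_eq_sum, tau, Finset.sum_range_succ]

section

variable [MeasurableSpace Ω] {P : Measure Ω} {lam : ℝ≥0}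
  {t : ℕ → Ω → ℝ} {a : ℕ → Ω → ℕ} {Δ : ℕ → Ω → ℝ}

lemma measurable_tauPrev (h : IsDelayedObservation P lam t a Δ) (n : ℕ) :
    Measurable (tauPrev Δ n) := by
  have : tauPrev Δ n = fun ω => ∑ i ∈ Finset.range n, Δ i ω := funext (tauPrev_eq_sum Δ n)
  rw [this]
  exact Finset.measurable_sum _ fun i _ => h.measurable_obs i

lemma measurable_tau (h : IsDelayedObservation P lam t a Δ) (n : ℕ) : Measurable (tau Δ n) :=
  measurable_tauPrev h (n + 1)

lemma tauPrev_nonneg (h : IsDelayedObservation P lam t a Δ) (n : ℕ) (ω : Ω) :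
    0 ≤ tauPrev Δ n ω := by
  rw [tauPrev_eq_sum]
  exact Finset.sum_nonneg fun i _ => h.nonneg_obs i ω

lemma tauPrev_mono (h : IsDelayedObservation P lam t a Δ) (ω : Ω) :
    Monotone fun n => tauPrev Δ n ω :=
  monotone_nat_of_le_succ fun n => by
    change tauPrev Δ n ω ≤ tau Δ n ω
    rw [tau_eq_tauPrev_add]
    linarith [h.nonneg_obs n ω]

/-- Almost surely `A_{n-1} = A(τ_{n-1})` for all `n`, including `n = 0`. -/
lemma ae_obsPrev_eq (h : IsDelayedObservation P lam t a Δ) :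
    ∀ᵐ ω ∂P, ∀ n, obsPrev t a Δ n ω = A t a (tauPrev Δ n ω) ω := by
  filter_upwards [h.poisson.pos] with ω hω n
  cases n with
  | zero =>
    simp only [obsPrev, tauPrev, A]
    simp [not_le.2 (hω _)]
  | succ n => rfl

/-! ### Laplace transforms of the observation intervals -/

lemma g_one [IsProbabilityMeasure P] : g P a 1 = 1 := by simp [g]

lemma rate_one [IsProbabilityMeasure P] : rate P lam a 1 = 0 := by simp [rate, g_one]

lemma norm_g_le_one [IsProbabilityMeasure P] {z : ℂ} (hz : ‖z‖ ≤ 1) : ‖g P a z‖ ≤ 1 := by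
  have := norm_integral_le_of_norm_le_const (μ := P) (f := fun ω => z ^ a 1 ω) (C := 1)
    (Eventually.of_forall fun ω => by
      rw [norm_pow]
      exact pow_le_one₀ (norm_nonneg _) hz)
  simpa [g] using this

lemma rate_re_nonneg [IsProbabilityMeasure P] {z : ℂ} (hz : ‖z‖ ≤ 1) :
    0 ≤ (rate P lam a z).re := by
  have h1 : (g P a z).re ≤ 1 := (Complex.re_le_norm _).trans (norm_g_le_one hz)
  have : (rate P lam a z).re = lam * (1 - (g P a z).re) := by
    simp [rate]
  rw [this]
  exact mul_nonneg lam.2 (by linarith)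

lemma norm_exp_neg_mul_le_one {α : ℂ} (hα : 0 ≤ α.re) {d : ℝ} (hd : 0 ≤ d) :
    ‖Complex.exp (-α * (d : ℂ))‖ ≤ 1 := by
  rw [Complex.norm_exp, Real.exp_le_one_iff]
  simp only [Complex.mul_re, Complex.neg_re, Complex.ofReal_re, Complex.ofReal_im, mul_zero,
    sub_zero]
  nlinarith

lemma integrable_exp_neg_mul [IsProbabilityMeasure P] {X : Ω → ℝ} (hX : Measurable X)
    (hX0 : ∀ ω, 0 ≤ X ω) {α : ℂ} (hα : 0 ≤ α.re) :
    Integrable (fun ω => Complex.exp (-α * (X ω : ℂ))) P :=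
  Integrable.of_bound (by fun_prop : Measurable _).aestronglyMeasurable 1
    (Eventually.of_forall fun ω => norm_exp_neg_mul_le_one hα (hX0 ω))

/-- Given the observation times, `X_n` is the increment of a compound Poisson process over a length
`Δ_n`. The base `1` discards the marks before `τ_{n-1}`, and the third increment is empty because `R
= Q = τ_n`. -/
lemma gam_eq [IsProbabilityMeasure P] (h : IsDelayedObservation P lam t a Δ) (n : ℕ) {z θ : ℂ}
    (hz : ‖z‖ ≤ 1) (hθ : 0 ≤ θ.re) :
    gam P t a Δ n z θ = ∫ ω, Complex.exp (-(θ + rate P lam a z) * (Δ n ω : ℂ)) ∂P := by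
  have key := integral_pow_A_random h (f := fun d => Complex.exp (-θ * (d n : ℂ)))
    (S := fun d => ∑ i ∈ Finset.range n, d i) (R := fun d => ∑ i ∈ Finset.range (n + 1), d i)
    (Q := fun d => ∑ i ∈ Finset.range (n + 1), d i) (by fun_prop) (by fun_prop) (by fun_prop)
    (by fun_prop) (integrable_exp_neg_mul (h.measurable_obs n) (h.nonneg_obs n) hθ)
    (fun d hd _ => ⟨Finset.sum_nonneg fun i _ => hd i, by
      rw [Finset.sum_range_succ]; linarith [hd n], le_rfl⟩)
    (z₀ := 1) (z₁ := z) (z₂ := z) (by simp) hz hz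
  refine Eq.trans (integral_congr_ae ?_) (key.trans (integral_congr_ae ?_))
  · filter_upwards [ae_obsPrev_eq h] with ω hω
    rw [incr, hω, obs, tauPrev_eq_sum, tau]
    simp [mul_comm]
  · refine Eventually.of_forall fun ω => ?_
    simp only [rate_one, Finset.sum_range_succ]
    rw [← Complex.exp_add]
    push_cast
    ring_nf

lemma gam_eq_gam_one [IsProbabilityMeasure P] (h : IsDelayedObservation P lam t a Δ) {n : ℕ}
    (hn : 1 ≤ n) {z θ : ℂ} (hz : ‖z‖ ≤ 1) (hθ : 0 ≤ θ.re) :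
    gam P t a Δ n z θ = gam P t a Δ 1 z θ := by
  rw [gam_eq h n hz hθ, gam_eq h 1 hz hθ]
  exact ((h.ident_obs n hn).comp
    (u := fun d : ℝ => Complex.exp (-(θ + rate P lam a z) * (d : ℂ))) (by fun_prop)).integral_eq

/-- The modulus is at most `E[e^{-Re θ Δ_1}]`, and equality of this with `1` would force `Δ_1 = 0`
almost surely. The bound makes the series over `n` converge and keeps the denominator of `B_3` away
from zero. -/
lemma norm_gam_one_lt_one [IsProbabilityMeasure P] (h : IsDelayedObservation P lam t a Δ)
    {z θ : ℂ} (hz : ‖z‖ ≤ 1) (hθ : 0 < θ.re) : ‖gam P t a Δ 1 z θ‖ < 1 := by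
  have hint : Integrable (fun ω => Real.exp (-θ.re * Δ 1 ω)) P :=
    Integrable.of_bound
      (by have := h.measurable_obs 1; fun_prop : Measurable _).aestronglyMeasurable 1 (Eventually.of_forall fun ω => by
        rw [Real.norm_of_nonneg (Real.exp_nonneg _), Real.exp_le_one_iff]
        nlinarith [h.nonneg_obs 1 ω])
  have h1 : ‖gam P t a Δ 1 z θ‖ ≤ ∫ ω, Real.exp (-θ.re * Δ 1 ω) ∂P := by
    refine norm_integral_le_of_norm_le hint (Eventually.of_forall fun ω => ?_)
    rw [norm_mul, norm_pow, Complex.norm_exp]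
    simp only [Complex.mul_re, Complex.neg_re, Complex.ofReal_re, Complex.ofReal_im, mul_zero,
      sub_zero]
    exact mul_le_of_le_one_left (Real.exp_nonneg _) (pow_le_one₀ (norm_nonneg _) hz)
  have hnn : ∀ ω, 0 ≤ 1 - Real.exp (-θ.re * Δ 1 ω) := fun ω => by
    rw [sub_nonneg, Real.exp_le_one_iff]
    nlinarith [h.nonneg_obs 1 ω]
  have h2 : 0 ≤ ∫ ω, (1 - Real.exp (-θ.re * Δ 1 ω)) ∂P := integral_nonneg hnn
  have h3 : ∫ ω, (1 - Real.exp (-θ.re * Δ 1 ω)) ∂P ≠ 0 := fun h0 => by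
    rw [integral_eq_zero_iff_of_nonneg hnn ((integrable_const _).sub hint)] at h0
    refine h.nondegenerate_obs ?_
    filter_upwards [h0] with ω hω
    have : Real.exp (-θ.re * Δ 1 ω) = 1 := by
      have hω' : 1 - Real.exp (-θ.re * Δ 1 ω) = 0 := hω
      linarith
    rw [Real.exp_eq_one_iff] at this
    simpa [hθ.ne'] using this
  rw [integral_sub (integrable_const _) hint] at h2 h3
  simp only [integral_const, probReal_univ, smul_eq_mul, mul_one] at h2 h3
  have := lt_of_le_of_ne h2 (Ne.symm h3)
  linarith

lemma integral_exp_tauPrev [IsProbabilityMeasure P] (h : IsDelayedObservation P lam t a Δ) (n : ℕ)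
    (α : ℂ) : ∫ ω, Complex.exp (-α * (tauPrev Δ n ω : ℂ)) ∂P =
      ∏ i ∈ Finset.range n, ∫ ω, Complex.exp (-α * (Δ i ω : ℂ)) ∂P := by
  have hK : iIndepFun (fun k : Finset.range n => Δ k) P :=
    h.indep_obs.precomp Subtype.val_injective
  have := hK.integral_fun_prod_comp (f := fun _ (d : ℝ) => Complex.exp (-α * (d : ℂ)))
    (fun k => (h.measurable_obs k).aemeasurable)
    (fun k => (by fun_prop : Measurable _).aestronglyMeasurable)
  rw [← Finset.prod_coe_sort (Finset.range n) fun i => ∫ ω, Complex.exp (-α * (Δ i ω : ℂ)) ∂P,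
    ← this]
  congr 1 with ω
  rw [Finset.prod_coe_sort (Finset.range n) fun i => Complex.exp (-α * (Δ i ω : ℂ)),
    ← Complex.exp_sum, tauPrev_eq_sum, ← Finset.mul_sum]
  push_cast
  rfl

/-! ### The contribution of one observation interval -/

/-- The weight carried by the point `r` of the observation interval `[τ_{n-1}, τ_n)`, with marks
counted by `z₀` up to `τ_{n-1}`, by `z₁` up to `r` and by `z₂` up to `τ_n`. -/
def kernel (t : ℕ → Ω → ℝ) (a : ℕ → Ω → ℕ) (Δ : ℕ → Ω → ℝ) (θ w x : ℂ) (n : ℕ) (z₀ z₁ z₂ : ℂ)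
    (r : ℝ) (ω : Ω) : ℂ :=
  {p : ℝ × Ω | tauPrev Δ n p.2 ≤ p.1 ∧ p.1 < tau Δ n p.2}.indicator
    (fun p => Complex.exp (-θ * (p.1 : ℂ)) *
        Complex.exp (-w * (tauPrev Δ n p.2 : ℂ) - x * (Δ n p.2 : ℂ)) *
      (z₀ ^ A t a (tauPrev Δ n p.2) p.2 *
        z₁ ^ (A t a p.1 p.2 - A t a (tauPrev Δ n p.2) p.2) *
        z₂ ^ (A t a (tau Δ n p.2) p.2 - A t a p.1 p.2))) (r, ω)

lemma measurable_A_comp (h : IsDelayedObservation P lam t a Δ) {X : Type*} [MeasurableSpace X]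
    {b : X → ℝ} {c : X → Ω} (hb : Measurable b) (hc : Measurable c) :
    Measurable fun p => A t a (b p) (c p) :=
  (measurable_A h.poisson.measurable h.measurable_mark).comp (hb.prodMk hc)

lemma measurableSet_interval (h : IsDelayedObservation P lam t a Δ) (n : ℕ) :
    MeasurableSet {p : ℝ × Ω | tauPrev Δ n p.2 ≤ p.1 ∧ p.1 < tau Δ n p.2} :=
  (measurableSet_le ((measurable_tauPrev h n).comp measurable_snd) measurable_fst).inter
    (measurableSet_lt measurable_fst ((measurable_tau h n).comp measurable_snd))

lemma measurable_kernel (h : IsDelayedObservation P lam t a Δ) (θ w x : ℂ) (n : ℕ)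
    (z₀ z₁ z₂ : ℂ) :
    Measurable fun p : ℝ × Ω => kernel t a Δ θ w x n z₀ z₁ z₂ p.1 p.2 := by
  have hT := measurable_tauPrev h n
  have hD := h.measurable_obs n
  have h0 := measurable_A_comp h (hT.comp measurable_snd) (measurable_snd (α := ℝ))
  have h1 := measurable_A_comp h (measurable_fst (β := Ω)) measurable_snd
  have h2 := measurable_A_comp h ((measurable_tau h n).comp measurable_snd)
    (measurable_snd (α := ℝ))
  have hpow : ∀ z : ℂ, Measurable fun n : ℕ => z ^ n := fun z => measurable_of_countable _
  refine Measurable.indicator ?_ (measurableSet_interval h n)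
  refine Measurable.mul (by fun_prop) ?_
  exact (((hpow z₀).comp h0).mul ((hpow z₁).comp (h1.sub h0))).mul ((hpow z₂).comp (h2.sub h1))

lemma norm_exp_weight_le (h : IsDelayedObservation P lam t a Δ) {θ w x : ℂ}
    (hw : 0 ≤ w.re) (hx : 0 ≤ x.re) (n : ℕ) (r : ℝ) (ω : Ω) :
    ‖Complex.exp (-θ * (r : ℂ)) *
        Complex.exp (-w * (tauPrev Δ n ω : ℂ) - x * (Δ n ω : ℂ))‖ ≤ Real.exp (-θ.re * r) := by
  rw [← Complex.exp_add, Complex.norm_exp, Real.exp_le_exp]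
  simp only [Complex.add_re, Complex.sub_re, Complex.mul_re, Complex.neg_re, Complex.ofReal_re,
    Complex.ofReal_im, mul_zero, sub_zero]
  nlinarith [mul_nonneg hw (tauPrev_nonneg h n ω), mul_nonneg hx (h.nonneg_obs n ω)]

lemma norm_kernel_le (h : IsDelayedObservation P lam t a Δ) {θ w x : ℂ}
    (hw : 0 ≤ w.re) (hx : 0 ≤ x.re) (n : ℕ) {z₀ z₁ z₂ : ℂ}
    (h₀ : ‖z₀‖ ≤ 1) (h₁ : ‖z₁‖ ≤ 1) (h₂ : ‖z₂‖ ≤ 1) (r : ℝ) (ω : Ω) :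
    ‖kernel t a Δ θ w x n z₀ z₁ z₂ r ω‖ ≤ Real.exp (-θ.re * r) := by
  refine (norm_indicator_le_norm_self _ _).trans ?_
  rw [norm_mul]
  exact (mul_le_of_le_one_right (norm_nonneg _) (norm_prod_pow_le_one h₀ h₁ h₂ _ _ _)).trans
    (norm_exp_weight_le h hw hx n r ω)

lemma integrable_exp_neg_Ici {c : ℝ} (hc : 0 < c) :
    Integrable (fun r => Real.exp (-c * r)) (volume.restrict (Set.Ici (0 : ℝ))) := by
  rw [← IntegrableOn, integrableOn_Ici_iff_integrableOn_Ioi]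
  exact exp_neg_integrableOn_Ioi 0 hc

lemma integrable_prod_of_exp_bound [IsProbabilityMeasure P] {c C : ℝ} (hc : 0 < c)
    {F : ℝ × Ω → ℂ} (hF : AEStronglyMeasurable F ((volume.restrict (Set.Ici (0 : ℝ))).prod P))
    (hb : ∀ r ω, ‖F (r, ω)‖ ≤ C * Real.exp (-c * r)) :
    Integrable F ((volume.restrict (Set.Ici (0 : ℝ))).prod P) :=
  (((integrable_exp_neg_Ici hc).const_mul C).comp_fst P).mono' hF
    (Eventually.of_forall fun p => hb p.1 p.2)

lemma indepFun_tauPrev [IsProbabilityMeasure P] (h : IsDelayedObservation P lam t a Δ) (n : ℕ) :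
    IndepFun (tauPrev Δ n) (Δ n) P := by
  have := h.indep_obs.indepFun_finsetSum_of_notMem h.measurable_obs
    (s := Finset.range n) (i := n) (by simp)
  convert! this using 1
  ext ω
  rw [tauPrev_eq_sum, Finset.sum_apply]

/-- As a function of `r` the integrand on `[T, T + D)` is a constant times `exp(-(θ + c₁ - c₂) r)`;
the two endpoints give the two exponentials in `D`. -/
lemma setIntegral_Ici_kernel_exponential {θ c₀ c₁ c₂ w x : ℂ} (hδ : θ + c₁ - c₂ ≠ 0)
    {T D : ℝ} (hT : 0 ≤ T) (hD : 0 ≤ D) :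
    ∫ r in Set.Ici (0 : ℝ), (Set.Ico T (T + D)).indicator (fun r : ℝ =>
      Complex.exp (-θ * (r : ℂ)) * Complex.exp (-w * (T : ℂ) - x * (D : ℂ)) *
        Complex.exp (-(c₀ * T) - c₁ * (r - T) - c₂ * ((T + D : ℝ) - r))) r =
      Complex.exp (-(θ + w + c₀) * (T : ℂ)) *
        ((Complex.exp (-(x + c₂) * (D : ℂ)) - Complex.exp (-(θ + x + c₁) * (D : ℂ))) /
          (θ + c₁ - c₂)) := by
  rw [setIntegral_indicator measurableSet_Ico,
    Set.inter_eq_self_of_subset_right (Set.Ico_subset_Ici_self.trans (Set.Ici_subset_Ici.2 hT)),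
    integral_Ico_eq_integral_Ioc,
    ← intervalIntegral.integral_of_le (by linarith)]
  have e : ∀ r : ℝ, Complex.exp (-θ * (r : ℂ)) * Complex.exp (-w * (T : ℂ) - x * (D : ℂ)) *
        Complex.exp (-(c₀ * T) - c₁ * (r - T) - c₂ * ((T + D : ℝ) - r)) =
      Complex.exp (-(w + c₀ - c₁ + c₂) * T - (x + c₂) * D) *
        Complex.exp (-(θ + c₁ - c₂) * (r : ℂ)) := fun r => by
    rw [← Complex.exp_add, ← Complex.exp_add, ← Complex.exp_add]
    push_cast
    ring_nf
  simp only [e]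
  rw [intervalIntegral.integral_const_mul, integral_exp_mul_complex (neg_ne_zero.2 hδ), div_neg,
    ← neg_div, neg_sub, mul_div_assoc', mul_div_assoc', mul_sub, mul_sub, ← Complex.exp_add,
    ← Complex.exp_add, ← Complex.exp_add, ← Complex.exp_add]
  push_cast
  ring_nf

/-- The marked process is averaged out for each fixed `r`; then the order of integration is
exchanged and the `r`-integral is explicit. It splits into a function of `τ_{n-1}` times a function
of `Δ_n`, which are independent. -/
lemma integral_kernel [IsProbabilityMeasure P] (h : IsDelayedObservation P lam t a Δ)
    {θ w x : ℂ} (hθ : 0 < θ.re) (hw : 0 ≤ w.re) (hx : 0 ≤ x.re) (n : ℕ) {z₀ z₁ z₂ : ℂ}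
    (h₀ : ‖z₀‖ ≤ 1) (h₁ : ‖z₁‖ ≤ 1) (h₂ : ‖z₂‖ ≤ 1)
    (hδ : θ + rate P lam a z₁ - rate P lam a z₂ ≠ 0) :
    ∫ r in Set.Ici (0 : ℝ), ∫ ω, kernel t a Δ θ w x n z₀ z₁ z₂ r ω ∂P =
      (∫ ω, Complex.exp (-(θ + w + rate P lam a z₀) * (tauPrev Δ n ω : ℂ)) ∂P) *
        ((gam P t a Δ n z₂ x - gam P t a Δ n z₁ (θ + x)) /
          (θ + rate P lam a z₁ - rate P lam a z₂)) := by
  set c₀ := rate P lam a z₀ with hc₀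
  set c₁ := rate P lam a z₁ with hc₁
  set c₂ := rate P lam a z₂ with hc₂
  have r₀ : 0 ≤ c₀.re := rate_re_nonneg h₀
  have r₁ : 0 ≤ c₁.re := rate_re_nonneg h₁
  have r₂ : 0 ≤ c₂.re := rate_re_nonneg h₂
  have hTm := measurable_tauPrev h n
  have hQm := measurable_tau h n
  have hDm := h.measurable_obs n
  let K : ℝ × Ω → ℂ := {p : ℝ × Ω | tauPrev Δ n p.2 ≤ p.1 ∧ p.1 < tau Δ n p.2}.indicator
    fun p => Complex.exp (-θ * (p.1 : ℂ)) *
        Complex.exp (-w * (tauPrev Δ n p.2 : ℂ) - x * (Δ n p.2 : ℂ)) *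
      Complex.exp (-(c₀ * tauPrev Δ n p.2) - c₁ * (p.1 - tauPrev Δ n p.2) -
        c₂ * (tau Δ n p.2 - p.1))
  have hKm : Measurable K := Measurable.indicator (by fun_prop) (measurableSet_interval h n)
  have hKb : ∀ r ω, ‖K (r, ω)‖ ≤ 1 * Real.exp (-θ.re * r) := by
    intro r ω
    by_cases hp : (r, ω) ∈ {p : ℝ × Ω | tauPrev Δ n p.2 ≤ p.1 ∧ p.1 < tau Δ n p.2}
    · simp only [K, Set.indicator_of_mem hp]
      have hp1 : tauPrev Δ n ω ≤ r := hp.1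
      have hp2 : r < tau Δ n ω := hp.2
      rw [norm_mul, one_mul]
      refine (mul_le_of_le_one_right (norm_nonneg _) ?_).trans (norm_exp_weight_le h hw hx n r ω)
      rw [Complex.norm_exp, Real.exp_le_one_iff]
      simp only [Complex.sub_re, Complex.mul_re, Complex.neg_re, Complex.ofReal_re,
        Complex.ofReal_im, mul_zero, sub_zero, Complex.sub_im, sub_self]
      nlinarith [mul_nonneg r₀ (tauPrev_nonneg h n ω), mul_nonneg r₁ (sub_nonneg.2 hp1),
        mul_nonneg r₂ (sub_nonneg.2 hp2.le)]
    · simp only [K, Set.indicator_of_notMem hp, norm_zero]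
      positivity
  have step : ∀ r : ℝ, ∫ ω, kernel t a Δ θ w x n z₀ z₁ z₂ r ω ∂P = ∫ ω, K (r, ω) ∂P := by
    intro r
    let S : (ℕ → ℝ) → ℝ := fun d => ∑ i ∈ Finset.range n, d i
    let Q : (ℕ → ℝ) → ℝ := fun d => ∑ i ∈ Finset.range (n + 1), d i
    have hS : Measurable S := by fun_prop
    have hQ : Measurable Q := by fun_prop
    -- The indicator of the interval is put into `f`, so that `S ≤ r ≤ Q` holds wherever `f` is
    -- nonzero.
    let f : (ℕ → ℝ) → ℂ := {d | S d ≤ r ∧ r < Q d}.indicator fun d =>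
      Complex.exp (-θ * (r : ℂ)) * Complex.exp (-w * (S d : ℂ) - x * (d n : ℂ))
    have hf : Measurable f := Measurable.indicator (by fun_prop)
      ((measurableSet_le hS measurable_const).inter (measurableSet_lt measurable_const hQ))
    have hSe : ∀ ω, S (fun n => Δ n ω) = tauPrev Δ n ω := fun ω => (tauPrev_eq_sum Δ n ω).symm
    have hfi : Integrable (fun ω => f fun n => Δ n ω) P := by
      refine Integrable.of_bound
        (hf.comp (measurable_pi_lambda _ h.measurable_obs)).aestronglyMeasurable
        (Real.exp (-θ.re * r)) (Eventually.of_forall fun ω => ?_)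
      refine (norm_indicator_le_norm_self _ _).trans ?_
      rw [hSe]
      exact norm_exp_weight_le h hw hx n r ω
    have key := integral_pow_A_random h hf hS (R := fun _ => r) measurable_const hQ hfi
      (fun d hd hfd => by
        have := Set.mem_of_indicator_ne_zero hfd
        exact ⟨Finset.sum_nonneg fun i _ => hd i, this.1, this.2.le⟩) h₀ h₁ h₂
    refine Eq.trans (integral_congr_ae (Eventually.of_forall fun ω => ?_))
      (key.trans (integral_congr_ae (Eventually.of_forall fun ω => ?_)))
    · by_cases hp : tauPrev Δ n ω ≤ r ∧ r < tau Δ n ω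
      · have hp' : (fun n => Δ n ω) ∈ {d | S d ≤ r ∧ r < Q d} := by
          rw [Set.mem_ofPred_eq, hSe]; exact hp
        simp only [kernel, f]
        rw [Set.indicator_of_mem hp', hSe, Set.indicator_of_mem (show (r, ω) ∈ _ from hp)]
        rfl
      · have hp' : (fun n => Δ n ω) ∉ {d | S d ≤ r ∧ r < Q d} := by
          rw [Set.mem_ofPred_eq, hSe]; exact hp
        simp only [kernel, f]
        rw [Set.indicator_of_notMem hp', zero_mul,
          Set.indicator_of_notMem (show (r, ω) ∉ _ from hp)]
    · by_cases hp : tauPrev Δ n ω ≤ r ∧ r < tau Δ n ω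
      · have hp' : (fun n => Δ n ω) ∈ {d | S d ≤ r ∧ r < Q d} := by
          rw [Set.mem_ofPred_eq, hSe]; exact hp
        simp only [K, f]
        rw [Set.indicator_of_mem hp', hSe, Set.indicator_of_mem (show (r, ω) ∈ _ from hp)]
        rfl
      · have hp' : (fun n => Δ n ω) ∉ {d | S d ≤ r ∧ r < Q d} := by
          rw [Set.mem_ofPred_eq, hSe]; exact hp
        simp only [K, f]
        rw [Set.indicator_of_notMem hp', zero_mul,
          Set.indicator_of_notMem (show (r, ω) ∉ _ from hp)]
  have inner : ∀ ω, ∫ r in Set.Ici (0 : ℝ), K (r, ω) =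
      Complex.exp (-(θ + w + c₀) * (tauPrev Δ n ω : ℂ)) *
        ((Complex.exp (-(x + c₂) * (Δ n ω : ℂ)) - Complex.exp (-(θ + x + c₁) * (Δ n ω : ℂ))) /
          (θ + c₁ - c₂)) := fun ω => by
    rw [← setIntegral_Ici_kernel_exponential hδ (tauPrev_nonneg h n ω) (h.nonneg_obs n ω)]
    congr 1 with r
    rw [← tau_eq_tauPrev_add]
    rfl
  simp only [step]
  rw [integral_integral_swap (f := fun r ω => K (r, ω))
    (integrable_prod_of_exp_bound hθ hKm.aestronglyMeasurable hKb)]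
  simp only [inner]
  rw [(indepFun_tauPrev h n).integral_fun_comp_mul_comp
    (f := fun T : ℝ => Complex.exp (-(θ + w + c₀) * (T : ℂ)))
    (g := fun D : ℝ => (Complex.exp (-(x + c₂) * (D : ℂ)) - Complex.exp (-(θ + x + c₁) * (D : ℂ))) /
          (θ + c₁ - c₂)) hTm.aemeasurable hDm.aemeasurable
    (by fun_prop : Measurable _).aestronglyMeasurable
    (by fun_prop : Measurable _).aestronglyMeasurable, integral_div, integral_sub,
    gam_eq h n h₂ hx, gam_eq h n h₁ (by simp; linarith)]
  · exact integrable_exp_neg_mul hDm (h.nonneg_obs n) (by simp; linarith)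
  · exact integrable_exp_neg_mul hDm (h.nonneg_obs n) (by simp; linarith)

end

/-- The difference of weights whose integral is the `n`-th term of the generating function. -/
def kernelDiff (t : ℕ → Ω → ℝ) (a : ℕ → Ω → ℕ) (Δ : ℕ → Ω → ℝ) (θ u v w x y s : ℂ) (n : ℕ)
    (p : ℝ × Ω) : ℂ :=
  kernel t a Δ θ w x n (u * v * y * s) (v * y) v p.1 p.2 -
    kernel t a Δ θ w x n (u * v * y * s) (v * s * y) (v * s) p.1 p.2

lemma kernelDiff_eq_zero {t : ℕ → Ω → ℝ} {a : ℕ → Ω → ℕ} {Δ : ℕ → Ω → ℝ} {n : ℕ} {r : ℝ} {ω : Ω}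
    (hn : ¬ (tauPrev Δ n ω ≤ r ∧ r < tau Δ n ω)) (θ u v w x y s : ℂ) :
    kernelDiff t a Δ θ u v w x y s n (r, ω) = 0 := by
  simp only [kernelDiff, kernel]
  rw [Set.indicator_of_notMem (show (r, ω) ∉ _ from hn),
    Set.indicator_of_notMem (show (r, ω) ∉ _ from hn), sub_zero]

section

variable [MeasurableSpace Ω] {P : Measure Ω} {lam : ℝ≥0}
  {t : ℕ → Ω → ℝ} {a : ℕ → Ω → ℕ} {Δ : ℕ → Ω → ℝ}

/-! ### Measurability and integrability of the functional -/

lemma measurable_obs_value (h : IsDelayedObservation P lam t a Δ) (n : ℕ) :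
    Measurable (obs t a Δ n) :=
  measurable_A_comp h (measurable_tau h n) measurable_id

lemma measurable_obsPrev (h : IsDelayedObservation P lam t a Δ) (n : ℕ) :
    Measurable (obsPrev t a Δ n) := by
  cases n with
  | zero => exact measurable_const
  | succ n => exact measurable_obs_value h n

lemma measurableSet_crossed (h : IsDelayedObservation P lam t a Δ) (M : ℕ) :
    MeasurableSet (crossed t a Δ M) := by
  have : crossed t a Δ M = ⋃ n, {ω | M < obs t a Δ n ω} := by
    ext ω; simp [crossed]
  rw [this]
  exact MeasurableSet.iUnion fun n =>
    measurableSet_lt measurable_const (measurable_obs_value h n)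

lemma measurable_exitIndex (h : IsDelayedObservation P lam t a Δ) (M : ℕ) :
    Measurable (exitIndex t a Δ M) := by
  classical
  -- Off `crossed` the infimum is over the empty set and equals `0`. The predicate is relaxed to
  -- hold for every `n` there, so its least solution is `0` too.
  have hex : ∀ ω, ∃ n, ω ∉ crossed t a Δ M ∨ M < obs t a Δ n ω := fun ω => by
    by_cases hω : ω ∈ crossed t a Δ M
    · obtain ⟨n, hn⟩ := hω
      exact ⟨n, Or.inr hn⟩
    · exact ⟨0, Or.inl hω⟩
  have hm := measurable_find hex fun k => (measurableSet_crossed h M).compl.union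
    (measurableSet_lt measurable_const (measurable_obs_value h k))
  convert! hm using 1
  ext ω
  rw [eq_comm, Nat.find_eq_iff, exitIndex]
  by_cases hω : ω ∈ crossed t a Δ M
  · exact ⟨Or.inr (Nat.sInf_mem (s := {n | M < obs t a Δ n ω}) hω), fun m hm hc =>
      hc.elim (fun hc => hc hω) (Nat.notMem_of_lt_sInf (s := {n | M < obs t a Δ n ω}) hm)⟩
  · have : {n | M < obs t a Δ n ω} = ∅ :=
      Set.eq_empty_iff_forall_notMem.2 fun n hn => hω ⟨n, hn⟩
    simp [this, hω]

lemma measurable_index_comp {X β : Type*} [MeasurableSpace X] [MeasurableSpace β]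
    {f : ℕ → X → β} {ν : X → ℕ} (hf : ∀ n, Measurable (f n)) (hν : Measurable ν) :
    Measurable fun x => f (ν x) x :=
  (measurable_from_prod_countable_right (f := fun p : ℕ × X => f p.1 p.2) hf).comp
    (hν.prodMk measurable_id)

lemma measurable_G2integrand (h : IsDelayedObservation P lam t a Δ) (M : ℕ) (u v w x y : ℂ) :
    Measurable fun p : ℝ × Ω => G2integrand t a Δ M u v w x y p.1 p.2 := by
  have hν := measurable_exitIndex h M
  have hsnd : Measurable (Prod.snd : ℝ × Ω → Ω) := measurable_snd
  have hTν := (measurable_index_comp (measurable_tauPrev h) hν).comp hsnd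
  have hQν := (measurable_index_comp (measurable_tau h) hν).comp hsnd
  have hDν := (measurable_index_comp h.measurable_obs hν).comp hsnd
  have hiν := (measurable_index_comp (measurable_obsPrev h) hν).comp hsnd
  have hkν := (measurable_index_comp (measurable_obs_value h) hν).comp hsnd
  have hA := measurable_A_comp h (measurable_fst (β := Ω)) measurable_snd
  have hpow : ∀ z : ℂ, Measurable fun n : ℕ => z ^ n := fun z => measurable_of_countable _
  have hset : MeasurableSet {p : ℝ × Ω | p.2 ∈ crossed t a Δ M ∧
      tauPrev Δ (exitIndex t a Δ M p.2) p.2 ≤ p.1 ∧ p.1 < tau Δ (exitIndex t a Δ M p.2) p.2} :=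
    (measurable_snd (measurableSet_crossed h M)).inter
      ((measurableSet_le hTν measurable_fst).inter (measurableSet_lt measurable_fst hQν))
  have hfun : Measurable fun p : ℝ × Ω =>
      u ^ obsPrev t a Δ (exitIndex t a Δ M p.2) p.2 * v ^ obs t a Δ (exitIndex t a Δ M p.2) p.2 *
        Complex.exp (-w * (tauPrev Δ (exitIndex t a Δ M p.2) p.2 : ℂ) -
          x * (Δ (exitIndex t a Δ M p.2) p.2 : ℂ)) * y ^ A t a p.1 p.2 := by
    refine Measurable.mul (Measurable.mul (((hpow u).comp hiν).mul ((hpow v).comp hkν)) ?_)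
      ((hpow y).comp hA)
    exact Complex.measurable_exp.comp
      (((Complex.measurable_ofReal.comp hTν).const_mul _).sub
        ((Complex.measurable_ofReal.comp hDν).const_mul _))
  exact hfun.indicator hset

lemma norm_G2integrand_le (h : IsDelayedObservation P lam t a Δ) (M : ℕ) {u v w x y : ℂ}
    (hu : ‖u‖ ≤ 1) (hv : ‖v‖ ≤ 1) (hy : ‖y‖ ≤ 1) (hw : 0 ≤ w.re) (hx : 0 ≤ x.re) (r : ℝ) (ω : Ω) :
    ‖G2integrand t a Δ M u v w x y r ω‖ ≤ 1 := by
  refine (norm_indicator_le_norm_self _ _).trans ?_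
  simp only
  rw [mul_right_comm, norm_mul]
  refine mul_le_one₀ (norm_prod_pow_le_one hu hv hy _ _ _) (norm_nonneg _) ?_
  rw [Complex.norm_exp, Real.exp_le_one_iff]
  simp only [Complex.sub_re, Complex.mul_re, Complex.neg_re, Complex.ofReal_re,
    Complex.ofReal_im, mul_zero, sub_zero]
  nlinarith [mul_nonneg hw (tauPrev_nonneg h (exitIndex t a Δ M ω) ω),
    mul_nonneg hx (h.nonneg_obs (exitIndex t a Δ M ω) ω)]

lemma integrable_G2integrand [IsProbabilityMeasure P] (h : IsDelayedObservation P lam t a Δ)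
    (M : ℕ) {u v w x y : ℂ} (hu : ‖u‖ ≤ 1) (hv : ‖v‖ ≤ 1) (hy : ‖y‖ ≤ 1)
    (hw : 0 ≤ w.re) (hx : 0 ≤ x.re) (r : ℝ) :
    Integrable (G2integrand t a Δ M u v w x y r) P :=
  Integrable.of_bound ((measurable_G2integrand h M u v w x y).comp
    measurable_prodMk_left).aestronglyMeasurable 1
    (Eventually.of_forall fun ω => norm_G2integrand_le h M hu hv hy hw hx r ω)

/-- The integrand of the Laplace transform on the product of the time axis and `Ω`. -/
def laplaceIntegrand (t : ℕ → Ω → ℝ) (a : ℕ → Ω → ℕ) (Δ : ℕ → Ω → ℝ) (θ u v w x y : ℂ) (M : ℕ)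
    (p : ℝ × Ω) : ℂ :=
  Complex.exp (-θ * (p.1 : ℂ)) * G2integrand t a Δ M u v w x y p.1 p.2

lemma measurable_laplaceIntegrand (h : IsDelayedObservation P lam t a Δ) (θ u v w x y : ℂ)
    (M : ℕ) : Measurable (laplaceIntegrand t a Δ θ u v w x y M) :=
  Measurable.mul (by fun_prop) (measurable_G2integrand h M u v w x y)

lemma norm_laplaceIntegrand_le (h : IsDelayedObservation P lam t a Δ) (M : ℕ) {θ u v w x y : ℂ}
    (hu : ‖u‖ ≤ 1) (hv : ‖v‖ ≤ 1) (hy : ‖y‖ ≤ 1) (hw : 0 ≤ w.re) (hx : 0 ≤ x.re) (r : ℝ) (ω : Ω) :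
    ‖laplaceIntegrand t a Δ θ u v w x y M (r, ω)‖ ≤ Real.exp (-θ.re * r) := by
  rw [laplaceIntegrand, norm_mul]
  refine (mul_le_of_le_one_right (norm_nonneg _)
    (norm_G2integrand_le h M hu hv hy hw hx r ω)).trans_eq ?_
  simp [Complex.norm_exp]

lemma integrable_laplaceIntegrand [IsProbabilityMeasure P] (h : IsDelayedObservation P lam t a Δ)
    (M : ℕ) {θ u v w x y : ℂ} (hθ : 0 < θ.re) (hu : ‖u‖ ≤ 1) (hv : ‖v‖ ≤ 1) (hy : ‖y‖ ≤ 1)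
    (hw : 0 ≤ w.re) (hx : 0 ≤ x.re) :
    Integrable (laplaceIntegrand t a Δ θ u v w x y M)
      ((volume.restrict (Set.Ici (0 : ℝ))).prod P) :=
  integrable_prod_of_exp_bound (C := 1) hθ
    (measurable_laplaceIntegrand h θ u v w x y M).aestronglyMeasurable fun r ω => by
      rw [one_mul]; exact norm_laplaceIntegrand_le h M hu hv hy hw hx r ω

lemma G2star_eq_integral_prod [IsProbabilityMeasure P] (h : IsDelayedObservation P lam t a Δ)
    (M : ℕ) {θ u v w x y : ℂ} (hθ : 0 < θ.re) (hu : ‖u‖ ≤ 1) (hv : ‖v‖ ≤ 1) (hy : ‖y‖ ≤ 1)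
    (hw : 0 ≤ w.re) (hx : 0 ≤ x.re) :
    G2star P t a Δ M θ u v w x y = ∫ p, laplaceIntegrand t a Δ θ u v w x y M p
      ∂((volume.restrict (Set.Ici (0 : ℝ))).prod P) := by
  rw [integral_prod _ (integrable_laplaceIntegrand h M hθ hu hv hy hw hx)]
  simp only [laplaceIntegrand, integral_const_mul]
  rfl

/-- The sum over `M` and the integral may be exchanged, since the `M`-th term is dominated by `|s|^M
e^{-Re θ r}`. -/
lemma hasSum_pow_mul_G2star [IsProbabilityMeasure P] (h : IsDelayedObservation P lam t a Δ)
    {θ u v w x y s : ℂ} (hθ : 0 < θ.re) (hu : ‖u‖ ≤ 1) (hv : ‖v‖ ≤ 1) (hy : ‖y‖ ≤ 1)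
    (hw : 0 ≤ w.re) (hx : 0 ≤ x.re) (hs : ‖s‖ < 1) :
    HasSum (fun M => s ^ M * G2star P t a Δ M θ u v w x y)
      (∫ p, ∑' M, s ^ M * laplaceIntegrand t a Δ θ u v w x y M p
        ∂((volume.restrict (Set.Ici (0 : ℝ))).prod P)) := by
  have hi := fun M => integrable_laplaceIntegrand h M hθ hu hv hy hw hx
  have hexp : Integrable (fun p : ℝ × Ω => Real.exp (-θ.re * p.1))
      ((volume.restrict (Set.Ici (0 : ℝ))).prod P) := (integrable_exp_neg_Ici hθ).comp_fst P
  have key := hasSum_integral_of_summable_integral_norm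
    (F := fun M p => s ^ M * laplaceIntegrand t a Δ θ u v w x y M p)
    (fun M => (hi M).const_mul _) (by
      refine Summable.of_nonneg_of_le (fun M => integral_nonneg fun p => norm_nonneg _)
        (fun M => ?_) ((summable_geometric_of_lt_one (norm_nonneg s) hs).mul_right
          (∫ p, Real.exp (-θ.re * p.1) ∂((volume.restrict (Set.Ici (0 : ℝ))).prod P)))
      rw [← integral_const_mul]
      refine integral_mono ((hi M).const_mul _).norm (hexp.const_mul _) fun p => ?_
      simp only [norm_mul, norm_pow]
      exact mul_le_mul_of_nonneg_left (norm_laplaceIntegrand_le h M hu hv hy hw hx p.1 p.2)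
        (by positivity))
  simpa only [integral_const_mul, ← G2star_eq_integral_prod h _ hθ hu hv hy hw hx] using key

/-! ### Decomposition along the observation intervals -/

lemma interval_index_unique (h : IsDelayedObservation P lam t a Δ) {m n : ℕ} {r : ℝ} {ω : Ω}
    (hm : tauPrev Δ m ω ≤ r ∧ r < tau Δ m ω) (hn : tauPrev Δ n ω ≤ r ∧ r < tau Δ n ω) :
    m = n := by
  rcases lt_trichotomy m n with hlt | heq | hlt
  · have : tau Δ m ω ≤ tauPrev Δ n ω := tauPrev_mono h ω (Nat.succ_le_of_lt hlt)
    linarith [hm.2, hn.1]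
  · exact heq
  · have : tau Δ n ω ≤ tauPrev Δ m ω := tauPrev_mono h ω (Nat.succ_le_of_lt hlt)
    linarith [hn.2, hm.1]

/-- Observed values are nondecreasing, so having no crossing before `n` is a condition on `A_{n-1}`
alone. -/
lemma exitIndex_eq_iff (h : IsDelayedObservation P lam t a Δ) {ω : Ω}
    (hfin : ∀ s : ℝ, {k | t k ω ≤ s}.Finite)
    (hprev : ∀ n, obsPrev t a Δ n ω = A t a (tauPrev Δ n ω) ω) (M n : ℕ) :
    (ω ∈ crossed t a Δ M ∧ exitIndex t a Δ M ω = n) ↔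
      obsPrev t a Δ n ω ≤ M ∧ M < obs t a Δ n ω := by
  constructor
  · rintro ⟨hc, rfl⟩
    refine ⟨?_, Nat.sInf_mem (s := {n | M < obs t a Δ n ω}) hc⟩
    rcases hm : exitIndex t a Δ M ω with _ | m
    · exact Nat.zero_le _
    · exact not_lt.1 (Nat.notMem_of_lt_sInf (s := {n | M < obs t a Δ n ω})
        (lt_of_lt_of_eq m.lt_succ_self hm.symm))
  · rintro ⟨h1, h2⟩
    refine ⟨⟨n, h2⟩, le_antisymm (Nat.sInf_le h2) (le_csInf ⟨n, h2⟩ fun m hm => ?_)⟩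
    by_contra hlt
    have : obs t a Δ m ω ≤ obsPrev t a Δ n ω := by
      rw [hprev]
      exact A_mono a hfin (tauPrev_mono h ω (Nat.succ_le_of_lt (not_le.1 hlt)))
    exact absurd hm (not_lt.2 (this.trans h1))

/-- Disjointness of the intervals forces `ν = n`, so `M` enters only through a finite window and the
series in `M` becomes a finite geometric sum. -/
lemma laplaceIntegrand_eq (h : IsDelayedObservation P lam t a Δ) {ω : Ω}
    (hfin : ∀ s : ℝ, {k | t k ω ≤ s}.Finite)
    (hprev : ∀ n, obsPrev t a Δ n ω = A t a (tauPrev Δ n ω) ω) {n : ℕ} {r : ℝ}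
    (hn : tauPrev Δ n ω ≤ r ∧ r < tau Δ n ω) (θ u v w x y : ℂ) (M : ℕ) :
    laplaceIntegrand t a Δ θ u v w x y M (r, ω) =
      if M ∈ Finset.Ico (A t a (tauPrev Δ n ω) ω) (A t a (tau Δ n ω) ω) then
        Complex.exp (-θ * (r : ℂ)) *
          Complex.exp (-w * (tauPrev Δ n ω : ℂ) - x * (Δ n ω : ℂ)) *
          (u ^ A t a (tauPrev Δ n ω) ω * v ^ A t a (tau Δ n ω) ω * y ^ A t a r ω)
      else 0 := by
  have hiff := exitIndex_eq_iff h hfin hprev M n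
  rw [hprev] at hiff
  simp only [laplaceIntegrand, G2integrand]
  split_ifs with hM
  · obtain ⟨hc, he⟩ := hiff.2 (Finset.mem_Ico.1 hM)
    rw [Set.indicator_of_mem (by refine ⟨hc, ?_⟩; rw [he]; exact hn)]
    simp only [he]
    rw [hprev, obs]
    ring
  · rw [Set.indicator_of_notMem, mul_zero]
    rintro ⟨hc, hr⟩
    exact hM (Finset.mem_Ico.2 (hiff.1 ⟨hc, interval_index_unique h hr hn⟩))

/-- The geometric sum over the window, times `1 - s`, is `s^{A_{n-1}} - s^{A_n}`. Its two terms are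
absorbed into the bases of the two kernels. -/
lemma kernelDiff_eq (h : IsDelayedObservation P lam t a Δ) {ω : Ω}
    (hfin : ∀ s : ℝ, {k | t k ω ≤ s}.Finite)
    (hprev : ∀ n, obsPrev t a Δ n ω = A t a (tauPrev Δ n ω) ω) {n : ℕ} {r : ℝ}
    (hn : tauPrev Δ n ω ≤ r ∧ r < tau Δ n ω) (θ u v w x y : ℂ) {s : ℂ} (hs : ‖s‖ < 1) :
    kernelDiff t a Δ θ u v w x y s n (r, ω) =
      (1 - s) * ∑' M, s ^ M * laplaceIntegrand t a Δ θ u v w x y M (r, ω) := by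
  have hs1 : s ≠ 1 := fun h1 => by simp [h1] at hs
  simp only [laplaceIntegrand_eq h hfin hprev hn]
  rw [tsum_eq_sum (s := Finset.Ico (A t a (tauPrev Δ n ω) ω) (A t a (tau Δ n ω) ω))
    fun M hM => by rw [if_neg hM, mul_zero]]
  rw [Finset.sum_congr rfl fun M hM => by rw [if_pos hM], ← Finset.sum_mul]
  have i1 : A t a (tauPrev Δ n ω) ω ≤ A t a r ω := A_mono a hfin hn.1
  have i2 : A t a r ω ≤ A t a (tau Δ n ω) ω := A_mono a hfin hn.2.le
  rw [geom_sum_Ico hs1 (i1.trans i2)]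
  simp only [kernelDiff, kernel]
  rw [Set.indicator_of_mem (show (r, ω) ∈ _ from hn),
    Set.indicator_of_mem (show (r, ω) ∈ _ from hn)]
  simp only
  -- With `b` and `c` the increments up to and after `r`, all exponents are sums of the same three
  -- numbers and the powers regroup.
  obtain ⟨b, hb⟩ := Nat.exists_eq_add_of_le i1
  obtain ⟨c, hc⟩ := Nat.exists_eq_add_of_le i2
  rw [hc, hb, Nat.add_sub_cancel_left, Nat.add_sub_cancel_left]
  have hs2 : s - 1 ≠ 0 := sub_ne_zero.2 hs1
  field_simp
  ring

lemma norm_kernelDiff_le (h : IsDelayedObservation P lam t a Δ) {θ u v w x y s : ℂ}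
    (hu : ‖u‖ ≤ 1) (hv : ‖v‖ ≤ 1) (hy : ‖y‖ ≤ 1) (hw : 0 ≤ w.re) (hx : 0 ≤ x.re) (hs : ‖s‖ ≤ 1)
    (n : ℕ) (r : ℝ) (ω : Ω) :
    ‖kernelDiff t a Δ θ u v w x y s n (r, ω)‖ ≤ 2 * Real.exp (-θ.re * r) := by
  rw [two_mul]
  exact (norm_sub_le _ _).trans (add_le_add
    (norm_kernel_le h hw hx n
      (norm_mul_le_one (norm_mul_le_one (norm_mul_le_one hu hv) hy) hs)
      (norm_mul_le_one hv hy) hv r ω)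
    (norm_kernel_le h hw hx n
      (norm_mul_le_one (norm_mul_le_one (norm_mul_le_one hu hv) hy) hs)
      (norm_mul_le_one (norm_mul_le_one hv hs) hy)
      (norm_mul_le_one hv hs) r ω))

/-- At most one term is nonzero, so the bound is uniform in `N` and can serve as the dominating
function. -/
lemma norm_sum_kernelDiff_le (h : IsDelayedObservation P lam t a Δ) {θ u v w x y s : ℂ}
    (hu : ‖u‖ ≤ 1) (hv : ‖v‖ ≤ 1) (hy : ‖y‖ ≤ 1) (hw : 0 ≤ w.re) (hx : 0 ≤ x.re) (hs : ‖s‖ ≤ 1)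
    (N : ℕ) (r : ℝ) (ω : Ω) :
    ‖∑ n ∈ Finset.range N, kernelDiff t a Δ θ u v w x y s n (r, ω)‖ ≤
      2 * Real.exp (-θ.re * r) := by
  by_cases hex : ∃ n ∈ Finset.range N, tauPrev Δ n ω ≤ r ∧ r < tau Δ n ω
  · obtain ⟨n, hnN, hn⟩ := hex
    rw [Finset.sum_eq_single_of_mem n hnN fun m _ hmn =>
      kernelDiff_eq_zero (fun hm => hmn (interval_index_unique h hm hn)) θ u v w x y s]
    exact norm_kernelDiff_le h hu hv hy hw hx hs n r ω
  · rw [Finset.sum_eq_zero fun n hn => kernelDiff_eq_zero (fun hm => hex ⟨n, hn, hm⟩) θ u v w x y s,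
      norm_zero]
    positivity

lemma tendsto_sum_kernelDiff (h : IsDelayedObservation P lam t a Δ) {ω : Ω}
    (hfin : ∀ s : ℝ, {k | t k ω ≤ s}.Finite)
    (hprev : ∀ n, obsPrev t a Δ n ω = A t a (tauPrev Δ n ω) ω) (r : ℝ)
    (θ u v w x y : ℂ) {s : ℂ} (hs : ‖s‖ < 1) :
    Tendsto (fun N => ∑ n ∈ Finset.range N, kernelDiff t a Δ θ u v w x y s n (r, ω)) atTop
      (𝓝 ((1 - s) * ∑' M, s ^ M * laplaceIntegrand t a Δ θ u v w x y M (r, ω))) := by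
  by_cases hex : ∃ n, tauPrev Δ n ω ≤ r ∧ r < tau Δ n ω
  · obtain ⟨n, hn⟩ := hex
    rw [← kernelDiff_eq h hfin hprev hn θ u v w x y hs]
    exact (hasSum_single n fun m hmn => kernelDiff_eq_zero
      (fun hm => hmn (interval_index_unique h hm hn)) θ u v w x y s).tendsto_sum_nat
  -- If no observation interval contains `r`, both sides vanish; hence `τ_n → ∞` is not needed.
  · have h0 : ∀ M, laplaceIntegrand t a Δ θ u v w x y M (r, ω) = 0 := fun M => by
      simp only [laplaceIntegrand, G2integrand]
      rw [Set.indicator_of_notMem, mul_zero]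
      rintro ⟨-, hr⟩
      exact hex ⟨_, hr⟩
    simp only [h0, mul_zero, tsum_zero]
    simp only [kernelDiff_eq_zero (fun hm => hex ⟨_, hm⟩), Finset.sum_const_zero]
    exact tendsto_const_nhds

lemma den_eq_rate (θ y z : ℂ) :
    den P lam a θ y z = θ + rate P lam a (z * y) - rate P lam a z := by
  simp only [den, rate]
  ring

lemma integrable_kernelDiff [IsProbabilityMeasure P] (h : IsDelayedObservation P lam t a Δ)
    {θ u v w x y s : ℂ} (hθ : 0 < θ.re) (hu : ‖u‖ ≤ 1) (hv : ‖v‖ ≤ 1) (hy : ‖y‖ ≤ 1)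
    (hw : 0 ≤ w.re) (hx : 0 ≤ x.re) (hs : ‖s‖ ≤ 1) (n : ℕ) :
    Integrable (kernelDiff t a Δ θ u v w x y s n)
      ((volume.restrict (Set.Ici (0 : ℝ))).prod P) :=
  integrable_prod_of_exp_bound hθ
    ((measurable_kernel h θ w x n _ _ _).sub
      (measurable_kernel h θ w x n _ _ _)).aestronglyMeasurable
    (norm_kernelDiff_le h hu hv hy hw hx hs n)

/-- Both kernels have the same base `uvys` before `τ_{n-1}`, so the factor from `τ_{n-1}` is common,
and it is a product over the independent `Δ_i`, `i < n`. -/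
lemma integral_kernelDiff [IsProbabilityMeasure P] (h : IsDelayedObservation P lam t a Δ)
    {θ u v w x y s : ℂ} (hθ : 0 < θ.re) (hu : ‖u‖ ≤ 1) (hv : ‖v‖ ≤ 1) (hy : ‖y‖ ≤ 1)
    (hw : 0 ≤ w.re) (hx : 0 ≤ x.re) (hs : ‖s‖ ≤ 1) (hden : den P lam a θ y v ≠ 0)
    (hdens : den P lam a θ y (v * s) ≠ 0) (n : ℕ) :
    ∫ p, kernelDiff t a Δ θ u v w x y s n p ∂((volume.restrict (Set.Ici (0 : ℝ))).prod P) =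
      (∏ i ∈ Finset.range n, gam P t a Δ i (u * v * y * s) (θ + w)) *
        Gam P lam t a Δ n θ v x y s := by
  have n₀ : ‖u * v * y * s‖ ≤ 1 := norm_mul_le_one (norm_mul_le_one (norm_mul_le_one hu hv) hy) hs
  have hk : ∀ {z₀ z₁ z₂ : ℂ}, ‖z₀‖ ≤ 1 → ‖z₁‖ ≤ 1 → ‖z₂‖ ≤ 1 →
      Integrable (fun p : ℝ × Ω => kernel t a Δ θ w x n z₀ z₁ z₂ p.1 p.2)
        ((volume.restrict (Set.Ici (0 : ℝ))).prod P) := fun h₀ h₁ h₂ =>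
    integrable_prod_of_exp_bound (C := 1) hθ
      (measurable_kernel h θ w x n _ _ _).aestronglyMeasurable fun r ω => by
        rw [one_mul]; exact norm_kernel_le h hw hx n h₀ h₁ h₂ r ω
  simp only [kernelDiff]
  rw [integral_sub (hk n₀ (norm_mul_le_one hv hy) hv)
      (hk n₀ (norm_mul_le_one (norm_mul_le_one hv hs) hy) (norm_mul_le_one hv hs)),
    integral_prod _ (hk n₀ (norm_mul_le_one hv hy) hv),
    integral_prod _ (hk n₀ (norm_mul_le_one (norm_mul_le_one hv hs) hy) (norm_mul_le_one hv hs))]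
  simp only
  rw [integral_kernel h hθ hw hx n n₀ (norm_mul_le_one hv hy) hv (by rwa [← den_eq_rate]),
    integral_kernel h hθ hw hx n n₀ (norm_mul_le_one (norm_mul_le_one hv hs) hy) (norm_mul_le_one hv hs)
      (by rwa [← den_eq_rate]),
    ← den_eq_rate, ← den_eq_rate, ← mul_sub, integral_exp_tauPrev h, Gam]
  congr 1
  refine Finset.prod_congr rfl fun i _ => ?_
  rw [gam_eq h i n₀ (by simp; linarith)]

lemma hasSum_integral_kernelDiff [IsProbabilityMeasure P] (h : IsDelayedObservation P lam t a Δ)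
    {θ u v w x y s : ℂ} (hθ : 0 < θ.re) (hu : ‖u‖ ≤ 1) (hv : ‖v‖ ≤ 1) (hy : ‖y‖ ≤ 1)
    (hw : 0 ≤ w.re) (hx : 0 ≤ x.re) (hs : ‖s‖ ≤ 1) (hden : den P lam a θ y v ≠ 0)
    (hdens : den P lam a θ y (v * s) ≠ 0) :
    HasSum (fun n => ∫ p, kernelDiff t a Δ θ u v w x y s n p
        ∂((volume.restrict (Set.Ici (0 : ℝ))).prod P))
      (Gam P lam t a Δ 0 θ v x y s + Gam P lam t a Δ 1 θ v x y s * B3 P t a Δ θ u v w y s) := by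
  have n₀ : ‖u * v * y * s‖ ≤ 1 := norm_mul_le_one (norm_mul_le_one (norm_mul_le_one hu hv) hy) hs
  have hθw : 0 < (θ + w).re := by simp; linarith
  have hθx : 0 ≤ (θ + x).re := by simp; linarith
  simp only [integral_kernelDiff h hθ hu hv hy hw hx hs hden hdens]
  -- The term `n = 0` is split off because `Δ_0` has its own law; the remaining terms are geometric.
  rw [← hasSum_nat_add_iff' 1]
  have hG : ∀ n, Gam P lam t a Δ (n + 1) θ v x y s = Gam P lam t a Δ 1 θ v x y s := fun n => by
    have hn : 1 ≤ n + 1 := by omega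
    simp only [Gam]
    rw [gam_eq_gam_one h hn hv hx, gam_eq_gam_one h hn (norm_mul_le_one hv hy) hθx,
      gam_eq_gam_one h hn (norm_mul_le_one hv hs) hx,
      gam_eq_gam_one h hn (norm_mul_le_one (norm_mul_le_one hv hs) hy) hθx]
  have hp : ∀ n, ∏ i ∈ Finset.range (n + 1), gam P t a Δ i (u * v * y * s) (θ + w) =
      gam P t a Δ 0 (u * v * y * s) (θ + w) * gam P t a Δ 1 (u * v * y * s) (θ + w) ^ n :=
    fun n => by
      rw [Finset.prod_range_succ', mul_comm]
      congr 1
      rw [Finset.prod_congr rfl fun i _ => gam_eq_gam_one h (by omega) n₀ hθw.le]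
      simp
  simp only [hG, hp]
  have hgeo := ((hasSum_geometric_of_norm_lt_one (norm_gam_one_lt_one h n₀ hθw)).mul_left
    (gam P t a Δ 0 (u * v * y * s) (θ + w))).mul_right (Gam P lam t a Δ 1 θ v x y s)
  convert! hgeo using 1
  simp [B3]
  ring

/-- The generating function in the threshold `M`. -/
lemma hasSum_pow_mul_G2star_eq [IsProbabilityMeasure P] (h : IsDelayedObservation P lam t a Δ)
    {θ u v w x y s : ℂ} (hθ : 0 < θ.re) (hu : ‖u‖ ≤ 1) (hv : ‖v‖ ≤ 1) (hy : ‖y‖ ≤ 1)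
    (hw : 0 ≤ w.re) (hx : 0 ≤ x.re) (hs : ‖s‖ < 1) (hden : den P lam a θ y v ≠ 0)
    (hdens : den P lam a θ y (v * s) ≠ 0) :
    HasSum (fun M => s ^ M * G2star P t a Δ M θ u v w x y)
      (1 / (1 - s) * (Gam P lam t a Δ 0 θ v x y s +
        Gam P lam t a Δ 1 θ v x y s * B3 P t a Δ θ u v w y s)) := by
  have hs1 : (1 : ℂ) - s ≠ 0 := sub_ne_zero.2 fun h1 => by simp [← h1] at hs
  have hgood : ∀ᵐ p : ℝ × Ω ∂((volume.restrict (Set.Ici (0 : ℝ))).prod P),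
      (∀ s : ℝ, {k | t k p.2 ≤ s}.Finite) ∧
        ∀ n, obsPrev t a Δ n p.2 = A t a (tauPrev Δ n p.2) p.2 :=
    Measure.quasiMeasurePreserving_snd.ae (h.poisson.locallyFinite.and (ae_obsPrev_eq h))
  have hlim := tendsto_integral_of_dominated_convergence
    (μ := (volume.restrict (Set.Ici (0 : ℝ))).prod P)
    (F := fun N p => ∑ n ∈ Finset.range N, kernelDiff t a Δ θ u v w x y s n p)
    (f := fun p => (1 - s) * ∑' M, s ^ M * laplaceIntegrand t a Δ θ u v w x y M p)
    (fun p => 2 * Real.exp (-θ.re * p.1))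
    (fun N => (integrable_finsetSum _ fun n _ =>
      integrable_kernelDiff h hθ hu hv hy hw hx hs.le n).aestronglyMeasurable)
    (((integrable_exp_neg_Ici hθ).const_mul 2).comp_fst P)
    (fun N => Eventually.of_forall fun p =>
      norm_sum_kernelDiff_le h hu hv hy hw hx hs.le N p.1 p.2)
    (by
      filter_upwards [hgood] with p hp
      exact tendsto_sum_kernelDiff h hp.1 hp.2 p.1 θ u v w x y hs)
  simp only [integral_finsetSum _ fun n _ =>
    integrable_kernelDiff h hθ hu hv hy hw hx hs.le n] at hlim
  -- The integrated partial sums have two limits, one by dominated convergence and one by the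
  -- geometric series.
  have huniq := tendsto_nhds_unique hlim
    (hasSum_integral_kernelDiff h hθ hu hv hy hw hx hs.le hden hdens).tendsto_sum_nat
  rw [integral_const_mul] at huniq
  rw [← huniq, ← mul_assoc, one_div_mul_cancel hs1, one_mul]
  exact hasSum_pow_mul_G2star h hθ hu hv hy hw hx hs

/-! ### Extraction of coefficients -/

lemma continuousAt_g_zero [IsProbabilityMeasure P] (h : IsDelayedObservation P lam t a Δ) :
    ContinuousAt (g P a) 0 := by
  refine continuousAt_of_dominated (bound := fun _ => 1)
    (Eventually.of_forall fun z => ((measurable_of_countable fun n : ℕ => z ^ n).comp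
      (h.measurable_mark 1)).aestronglyMeasurable) ?_ (integrable_const _)
    (Eventually.of_forall fun ω => by fun_prop)
  filter_upwards [Metric.ball_mem_nhds (0 : ℂ) one_pos] with z hz
  refine Eventually.of_forall fun ω => ?_
  rw [norm_pow]
  exact pow_le_one₀ (norm_nonneg _) (by simpa using (mem_ball_zero_iff.1 hz).le)

/-- At `s = 0` the two values of `g` cancel and the denominator is `θ ≠ 0`; continuity of `g` at `0`
does the rest. -/
lemma eventually_den_ne_zero [IsProbabilityMeasure P] (h : IsDelayedObservation P lam t a Δ)
    {θ : ℂ} (hθ : 0 < θ.re) (v y : ℂ) : ∀ᶠ s : ℂ in 𝓝 0, den P lam a θ y (v * s) ≠ 0 := by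
  have hg := continuousAt_g_zero h
  have h1 : ContinuousAt (fun s : ℂ => g P a (v * s)) 0 :=
    ContinuousAt.comp (g := g P a) (f := fun s : ℂ => v * s) (by simpa using hg) (by fun_prop)
  have h2 : ContinuousAt (fun s : ℂ => g P a (v * s * y)) 0 :=
    ContinuousAt.comp (g := g P a) (f := fun s : ℂ => v * s * y) (by simpa using hg) (by fun_prop)
  have hc : ContinuousAt (fun s => den P lam a θ y (v * s)) 0 := by
    simp only [den]
    exact (continuousAt_const.add (continuousAt_const.mul h1)).sub (continuousAt_const.mul h2)
  refine hc.eventually_ne ?_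
  simp only [den, mul_zero, zero_mul, add_sub_cancel_right]
  intro h0
  simp [h0] at hθ

/-- The hypothesis is a power series expansion of `φ(s)/(1-s)`, and multiplying by `1 - s` recovers
an analytic `φ`. The derivative is continuous at `0`, so the punctured limit is its value there, a
Taylor coefficient. -/
lemma calD_eq_of_hasSum {φ : ℂ → ℂ} {c : ℕ → ℂ}
    (hφ : ∀ᶠ s in 𝓝 (0 : ℂ), HasSum (fun n => s ^ n * c n) (1 / (1 - s) * φ s)) (k : ℕ) :
    AnalyticAt ℂ φ 0 ∧ calD k φ = c k := by
  have hps : HasFPowerSeriesAt (fun s => 1 / (1 - s) * φ s)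
      (FormalMultilinearSeries.ofScalars ℂ c) 0 := by
    rw [hasFPowerSeriesAt_iff]
    simpa only [FormalMultilinearSeries.coeff_ofScalars, smul_eq_mul, zero_add] using hφ
  have han : AnalyticAt ℂ (fun s => 1 / (1 - s) * φ s) 0 := ⟨_, hps⟩
  refine ⟨?_, ?_⟩
  · have hlin : AnalyticAt ℂ (fun s : ℂ => 1 - s) 0 := by fun_prop
    refine (hlin.mul han).congr ?_
    filter_upwards [hlin.continuousAt.eventually_ne (show (1 : ℂ) - 0 ≠ 0 by simp)] with s hs
    simp only [Pi.mul_apply]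
    rw [← mul_assoc, mul_one_div_cancel hs, one_mul]
  · have hcoeff : iteratedDeriv k (fun s => 1 / (1 - s) * φ s) 0 / (k.factorial : ℂ) = c k := by
      have := congrArg (fun p : FormalMultilinearSeries ℂ ℂ ℂ => p.coeff k)
        (han.hasFPowerSeriesAt.eq_formalMultilinearSeries hps)
      simpa only [FormalMultilinearSeries.coeff_ofScalars] using this
    have hcont : ContinuousAt (iteratedDeriv k fun s => 1 / (1 - s) * φ s) 0 := by
      rw [iteratedDeriv_eq_iterate]
      exact (han.iterated_deriv k).continuousAt
    rw [← hcoeff, div_eq_inv_mul, ← one_div]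
    exact ((continuousAt_const.mul hcont).tendsto.mono_left nhdsWithin_le_nhds).limUnder_eq

end

end DelayedPassage

end

/-! ### The formula for the transform -/

theorem mainTheorem2 {Ω : Type*} [MeasurableSpace Ω] (P : MeasureTheory.Measure Ω)
    [MeasureTheory.IsProbabilityMeasure P] (lam : ℝ≥0)
    (t : ℕ → Ω → ℝ) (a : ℕ → Ω → ℕ) (Δ : ℕ → Ω → ℝ)
    (h : DelayedPassage.IsDelayedObservation P lam t a Δ)
    (M : ℕ) (θ u v w x y : ℂ)
    (hθ : 0 < θ.re) (hu : ‖u‖ ≤ 1) (hv : ‖v‖ ≤ 1) (hy : ‖y‖ ≤ 1)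
    (hw : 0 ≤ w.re) (hx : 0 ≤ x.re)
    (hden : DelayedPassage.den P lam a θ y v ≠ 0) :
    -- the expectation and the Laplace integral converge absolutely
    (∀ r : ℝ, 0 ≤ r → Integrable (DelayedPassage.G2integrand t a Δ M u v w x y r) P) ∧
    IntegrableOn
      (fun r : ℝ => Complex.exp (-θ * (r : ℂ)) * DelayedPassage.G2 P t a Δ M u v w x y r)
      (Set.Ici 0) ∧
    -- near `s = 0` the remaining denominators do not vanish, and the argument of the operator is
    -- analytic there
    (∀ᶠ s : ℂ in 𝓝 0, DelayedPassage.den P lam a θ y (v * s) ≠ 0 ∧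
      1 - DelayedPassage.gam P t a Δ 1 (u * v * y * s) (θ + w) ≠ 0) ∧
    AnalyticAt ℂ
      (fun s => DelayedPassage.Gam P lam t a Δ 0 θ v x y s +
        DelayedPassage.Gam P lam t a Δ 1 θ v x y s * DelayedPassage.B3 P t a Δ θ u v w y s) 0 ∧
    DelayedPassage.G2star P t a Δ M θ u v w x y =
      DelayedPassage.calD M
        (fun s => DelayedPassage.Gam P lam t a Δ 0 θ v x y s +
          DelayedPassage.Gam P lam t a Δ 1 θ v x y s *
            DelayedPassage.B3 P t a Δ θ u v w y s) := by
  have hevent : ∀ᶠ s : ℂ in 𝓝 0, ‖s‖ < 1 ∧ DelayedPassage.den P lam a θ y (v * s) ≠ 0 := by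
    refine Eventually.and ?_ (DelayedPassage.eventually_den_ne_zero h hθ v y)
    filter_upwards [Metric.ball_mem_nhds (0 : ℂ) one_pos] with s hs using mem_ball_zero_iff.1 hs
  -- The expansion involves the transforms for all thresholds at once; the final argument `M`
  -- selects one coefficient.
  have hseries := DelayedPassage.calD_eq_of_hasSum
    (c := fun M => DelayedPassage.G2star P t a Δ M θ u v w x y)
    (hevent.mono fun s hs => DelayedPassage.hasSum_pow_mul_G2star_eq h hθ hu hv hy hw hx hs.1
      hden hs.2) M
  refine ⟨fun r _ => DelayedPassage.integrable_G2integrand h M hu hv hy hw hx r, ?_, ?_,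
    hseries.1, hseries.2.symm⟩
  · have := (DelayedPassage.integrable_laplaceIntegrand h M hθ hu hv hy hw hx).integral_prod_left
    simp only [DelayedPassage.laplaceIntegrand, integral_const_mul] at this
    exact this
  · refine hevent.mono fun s hs => ⟨hs.2, sub_ne_zero.2 fun h1 => ?_⟩
    have hz : ‖u * v * y * s‖ ≤ 1 := by
      simp only [norm_mul]
      exact mul_le_one₀ (mul_le_one₀ (mul_le_one₀ hu (norm_nonneg _) hv) (norm_nonneg _) hy)
        (norm_nonneg _) hs.1.le
    have := DelayedPassage.norm_gam_one_lt_one h hz (θ := θ + w) (by simp; linarith)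
    rw [← h1] at this
    simp at this
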